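/- **Setting.** Let $(\mathcal S,\mathcal A,\mathcal P,\mathcal R,\gamma,\rho)$ be a Markov decision process with transition kernel $\mathcal P$, reward function $\mathcal R$, discount factor $\gamma\in[0,1)$, initial law $\rho$ and finite horizon $\bar H$, and let $\pi_\theta(\cdot|s)$, $\theta\in\mathbb R^d$, be policies with positive densities on $\mathcal A$ with respect to a $\sigma$-finite measure. Let $p(\cdot|\theta)$ be the law of the trajectory $\tau=(s_0,a_0,\dots,s_{\bar H},a_{\bar H})$ under $\pi_\theta$, with density $p(\tau|\theta)=\rho(s_0)\pi_\theta(a_0|s_0)\prod_{i<\bar H}\mathcal P(s_{i+1}|s_i,a_i)\pi_\theta(a_{i+1}|s_{i+1})$, let $J(\theta)=\mathbb E_{\tau\sim p(\cdot|\theta)}\sum_{t=0}^{\bar H}\gamma^t\mathcal R(s_t,a_t)$, and let $\omega(\tau|\theta_1,\theta_2)=p(\tau|\theta_2)/p(\tau|\theta_1)$. The trajectory gradient $g$ is, for a bounded baseline $b:\mathcal S\times\mathcal A\to\mathbb R$, either REINFORCE, $g(\tau|\theta)=\big(\sum_{t=0}^{\bar H}(\gamma^t\mathcal R(s_t,a_t)-b(s_t,a_t))\big)\sum_{t=0}^{\bar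 H}\nabla_\theta\log\pi_\theta(a_t|s_t)$, or G(PO)MDP, $g(\tau|\theta)=\sum_{t=0}^{\bar H}(\gamma^t\mathcal R(s_t,a_t)-b(s_t,a_t))\sum_{i=0}^{t}\nabla_\theta\log\pi_\theta(a_i|s_i)$. **Assumptions.** (1) $J$ is differentiable and $\mathbb E_{\tau\sim p(\cdot|\theta)}[g(\tau|\theta)]=\nabla J(\theta)$ for all $\theta$. (2) $\log\pi_\theta(a|s)$ is twice differentiable in $\theta$, and there are constants $G,H,R<\infty$ such that $|\partial_{\theta_i}\log\pi_\theta(a|s)|\le G$, $|\partial_{\theta_i}\partial_{\theta_j}\log\pi_\theta(a|s)|\le H$ and $|\mathcal R(s,a)|\le R$ for all $s,a,\theta,i,j$. (3) There is $\sigma>0$ with $\mathbb E_{\tau\sim p(\cdot|\theta)}\|g(\tau|\theta)-\nabla J(\theta)\|^2\le\sigma^2$ for all $\theta$. **Constants.** There are constants $L>0$, $L_g\ge0$, $\Gamma>0$ such that $\nabla J$ is $L$-Lipschitz and, for every trajectory $\tau$, $g(\tau|\cdot)$ is $L_g$-Lipschitz and $\|g(\tau|\cdot)\|^2\le\Gamma$.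 If the variances $\mathrm{Var}_{\tau\sim p(\cdot|\theta_1)}\,\omega(\tau|\theta_1,\theta_2)$ are bounded uniformly in $\theta_1,\theta_2$, there is also a constant $C>0$ such that $$\mathrm{Var}_{\tau\sim p(\cdot|\theta_1)}\,\omega(\tau|\theta_1,\theta_2)=\mathbb E_{\tau\sim p(\cdot|\theta_1)}|1-\omega(\tau|\theta_1,\theta_2)|^2\le C\|\theta_1-\theta_2\|^2\quad\text{for all }\theta_1,\theta_2.$$ **Algorithm (AbaSVRPG).** Given $\theta_0\in\mathbb R^d$ and integers $m,B\ge1$, for $k=0,\dots,K$ put $n_k=\lfloor k/m\rfloor m$ and do the following. If $k=n_k$, draw $N=\Big\lceil\frac{\alpha\sigma^2}{\frac\beta m\sum_{i=n_k-m}^{n_k-1}\|v_i\|^2+\epsilon}\Big\rceil$ trajectories $\tau_i$ (with $v_i=0$ for $i<0$), i.i.d. from $p(\cdot|\theta_k)$ given the past, and put $v_k=\frac1N\sum_{i=1}^Ng(\tau_i|\theta_k)$. Otherwise draw $B$ trajectories, i.i.d. from $p(\cdot|\theta_k)$ given the past, and put $v_k=\frac1B\sum_{i=1}^B\big(g(\tau_i|\theta_k)-\omega(\tau_i|\theta_k,\theta_{n_k})\,g(\tau_i|\theta_{n_k})\big)+v_{n_k}$.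 Then set $\theta_{k+1}=\theta_k+\eta v_k$. The output is $\theta_\xi$ with $\xi$ uniform on $\{0,\dots,K\}$ and independent of the iterates. **Theorem.** Let (1)–(3) hold. Then the constants $L,L_g,\Gamma$ (and $C$, if the weight variances are bounded) exist as stated. Moreover, let $L,L_g,\Gamma,C$ be any constants with the properties above, put $Q=2(L_g^2+\Gamma C)$, let $\epsilon>0$, let $\theta^*$ be a maximizer of $J$, and take $\eta=\frac1{2L}$, $\alpha=48$, $\beta=6$, $m\ge1$ equal to $\big(\frac{L^2\sigma^2}{Q\epsilon}\big)^{1/3}$ rounded up or down to an integer, and $B=\Big\lceil\big(\frac{Q\sigma^4}{L^2\epsilon^2}\big)^{1/3}\Big\rceil$. Then for every $K\ge0$ and every $\theta_0$ the output of AbaSVRPG satisfies $$\mathbb E\|\nabla J(\theta_\xi)\|^2\le\frac{88L}{K+1}\big(J(\theta^*)-J(\theta_0)\big)+\frac\epsilon2 .$$ -/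

import Mathlib

open MeasureTheory ProbabilityTheory
open scoped ENNReal

namespace AbaPG

/-- The parameter space `ℝ^d` with its Euclidean norm. -/
abbrev Param (d : ℕ) : Type := EuclideanSpace ℝ (Fin d)

/-- A finite-horizon discounted Markov decision process with state space `S` and action space `A`;
the time steps are `0, 1, …, horizon`. -/
structure MDP (S A : Type*) [MeasurableSpace S] [MeasurableSpace A] where
  /-- law of the next state, given the current state and action -/
  transition : Kernel (S × A) S
  /-- reward function -/
  reward : S → A → ℝ
  /-- discount factor -/
  γ : ℝ
  /-- distribution of the initial state -/
  ρ : Measure S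
  /-- last time step of a trajectory -/
  horizon : ℕ
  markov : IsMarkovKernel transition
  prob : IsProbabilityMeasure ρ
  measurable_reward : Measurable (Function.uncurry reward)
  γ_nonneg : 0 ≤ γ
  γ_lt_one : γ < 1

/-- A class of policies `π_θ(· | s)`, `θ ∈ ℝ^d`, given by positive probability densities with
respect to a reference measure `ν` on the action space. -/
structure PolicyClass (S : Type*) {A : Type*} [MeasurableSpace S] [MeasurableSpace A]
    (ν : Measure A) (d : ℕ) where
  /-- `dens θ s a` is `π_θ(a | s)` -/
  dens : Param d → S → A → ℝ
  measurable_dens : ∀ θ, Measurable (Function.uncurry (dens θ))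
  dens_pos : ∀ θ s a, 0 < dens θ s a
  lintegral_dens : ∀ θ s, ∫⁻ a, ENNReal.ofReal (dens θ s a) ∂ν = 1

/-- A trajectory `(s_0, a_0, …, s_n, a_n)`. -/
abbrev Traj (S A : Type*) (n : ℕ) : Type _ := Fin (n + 1) → S × A

namespace PolicyClass

variable {S A : Type*} [MeasurableSpace S] [MeasurableSpace A] {ν : Measure A} {d : ℕ}

/-- `log π_θ(a | s)`, as a function of `θ`. -/
noncomputable def logDens (π : PolicyClass S ν d) (s : S) (a : A) (θ : Param d) : ℝ :=
  Real.log (π.dens θ s a)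

/-- The score `∇_θ log π_θ(a | s)`. -/
noncomputable def score (π : PolicyClass S ν d) (θ : Param d) (x : S × A) : Param d :=
  gradient (π.logDens x.1 x.2) θ

/-- The policy part `∏_t π_θ(a_t | s_t)` of the trajectory density `p(τ | θ)`: this is the density
of `p(· | θ)` with respect to `MDP.refMeasure`, which carries the factors of `p(τ | θ)` that do
not depend on `θ` (initial law and transitions). -/
noncomputable def trajDens (π : PolicyClass S ν d) {n : ℕ} (θ : Param d) (τ : Traj S A n) : ℝ :=
  ∏ t, π.dens θ (τ t).1 (τ t).2

/-- The importance weight `ω(τ | θ₁, θ₂) = p(τ | θ₂) / p(τ | θ₁)`. -/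
noncomputable def weight (π : PolicyClass S ν d) {n : ℕ} (θ₁ θ₂ : Param d) (τ : Traj S A n) : ℝ :=
  π.trajDens θ₂ τ / π.trajDens θ₁ τ

/-- `log π_θ(a | s)` is twice differentiable in `θ`, all its first order partial derivatives are
bounded by `G` and all its second order partial derivatives by `H`, uniformly in `θ, s, a`. -/
structure BoundedLogDerivs (π : PolicyClass S ν d) (G H : ℝ) : Prop where
  differentiable : ∀ s a, Differentiable ℝ (π.logDens s a)
  differentiable_fderiv : ∀ s a, Differentiable ℝ (fderiv ℝ (π.logDens s a))
  partial_le : ∀ s a θ (i : Fin d),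
    |fderiv ℝ (π.logDens s a) θ (EuclideanSpace.single i 1)| ≤ G
  partial_partial_le : ∀ s a θ (i j : Fin d),
    |fderiv ℝ (fun θ' => fderiv ℝ (π.logDens s a) θ' (EuclideanSpace.single j 1)) θ
      (EuclideanSpace.single i 1)| ≤ H

end PolicyClass

namespace MDP

variable {S A : Type*} [MeasurableSpace S] [MeasurableSpace A]

instance (M : MDP S A) : IsMarkovKernel M.transition := M.markov
instance (M : MDP S A) : IsProbabilityMeasure M.ρ := M.prob

/-- One transition: the next state has law `transition`, the next action the (possibly infinite)
reference measure `ν`. -/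
noncomputable def refStep (M : MDP S A) (ν : Measure A) : Kernel (S × A) (S × A) :=
  M.transition ×ₖ Kernel.const (S × A) ν

/-- The measure `ρ(ds_0) ν(da_0) ∏_{i<n} P(ds_{i+1} | s_i, a_i) ν(da_{i+1})` on trajectories. -/
noncomputable def refMeasure (M : MDP S A) (ν : Measure A) : (n : ℕ) → Measure (Traj S A n)
  | 0 => (M.ρ.prod ν).map (fun x _ => x)
  | n + 1 =>
    ((M.refMeasure ν n) ⊗ₘ
      ((M.refStep ν).comap (fun τ : Traj S A n => τ (Fin.last n)) (measurable_pi_apply _))).map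
        (fun q => (Fin.snoc q.1 q.2 : Traj S A (n + 1)))

variable {ν : Measure A} {d : ℕ}

/-- The law `p(· | θ)` of a trajectory under the policy `π_θ`:
`ρ(ds_0) π_θ(a_0 | s_0) ν(da_0) ∏_{i<H} P(ds_{i+1} | s_i, a_i) π_θ(a_{i+1} | s_{i+1}) ν(da_{i+1})`.
-/
noncomputable def trajLaw (M : MDP S A) (π : PolicyClass S ν d) (θ : Param d) :
    Measure (Traj S A M.horizon) :=
  (M.refMeasure ν M.horizon).withDensity (fun τ => ENNReal.ofReal (π.trajDens θ τ))

-- The trajectory law has total mass one.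

instance (M : MDP S A) (ν : Measure A) [SigmaFinite ν] : IsSFiniteKernel (M.refStep ν) := by
  unfold refStep; infer_instance

instance (M : MDP S A) (ν : Measure A) [SigmaFinite ν] (n : ℕ) : SFinite (M.refMeasure ν n) := by
  induction n with
  | zero => unfold refMeasure; infer_instance
  | succ n ih => unfold refMeasure; infer_instance

theorem measurable_snoc (n : ℕ) :
    Measurable (fun q : Traj S A n × (S × A) => (Fin.snoc q.1 q.2 : Traj S A (n + 1))) := by
  rw [measurable_pi_iff]
  intro i
  refine Fin.lastCases ?_ (fun j => ?_) i
  · simpa using measurable_snd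
  · simp only [Fin.snoc_castSucc]
    exact (measurable_pi_apply j).comp measurable_fst

theorem measurable_trajDens (π : PolicyClass S ν d) (n : ℕ) (θ : Param d) :
    Measurable (π.trajDens θ : Traj S A n → ℝ) := by
  unfold PolicyClass.trajDens
  exact Finset.measurable_prod _ fun t _ => (π.measurable_dens θ).comp (measurable_pi_apply t)

theorem lintegral_trajDens (M : MDP S A) [SigmaFinite ν] (π : PolicyClass S ν d) (θ : Param d)
    (n : ℕ) : ∫⁻ τ, ENNReal.ofReal (π.trajDens θ τ) ∂(M.refMeasure ν n) = 1 := by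
  have hm : Measurable fun x : S × A => ENNReal.ofReal (π.dens θ x.1 x.2) :=
    (π.measurable_dens θ).ennreal_ofReal
  induction n with
  | zero =>
    have hc : Measurable fun (x : S × A) (_ : Fin (0 + 1)) => x :=
      measurable_pi_lambda _ fun _ => measurable_id
    rw [refMeasure, lintegral_map (measurable_trajDens π _ θ).ennreal_ofReal hc]
    have h (x : S × A) : π.trajDens θ (fun _ => x : Traj S A 0) = π.dens θ x.1 x.2 := by
      simp [PolicyClass.trajDens]
    simp only [h]
    rw [lintegral_prod _ hm.aemeasurable]
    simp [π.lintegral_dens]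
  | succ n ih =>
    rw [refMeasure, lintegral_map (measurable_trajDens π _ θ).ennreal_ofReal (measurable_snoc n),
      Measure.lintegral_compProd (f := fun q : Traj S A n × (S × A) =>
          ENNReal.ofReal (π.trajDens θ (Fin.snoc q.1 q.2 : Traj S A (n + 1))))
        ((measurable_trajDens π _ θ).ennreal_ofReal.comp (measurable_snoc n)), ← ih]
    refine lintegral_congr fun τ => ?_
    have h (x : S × A) : ENNReal.ofReal (π.trajDens θ (Fin.snoc τ x : Traj S A (n + 1)))
        = ENNReal.ofReal (π.trajDens θ τ) * ENNReal.ofReal (π.dens θ x.1 x.2) := by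
      rw [← ENNReal.ofReal_mul (show 0 ≤ π.trajDens θ τ from
        Finset.prod_nonneg fun t _ => (π.dens_pos θ _ _).le)]
      simp [PolicyClass.trajDens, Fin.prod_univ_castSucc]
    simp only [h]
    rw [lintegral_const_mul _ hm, Kernel.comap_apply, refStep, Kernel.prod_apply,
      Kernel.const_apply, lintegral_prod _ hm.aemeasurable]
    simp [π.lintegral_dens]

instance (M : MDP S A) [SigmaFinite ν] (π : PolicyClass S ν d) (θ : Param d) :
    IsProbabilityMeasure (M.trajLaw π θ) :=
  ⟨by rw [trajLaw, withDensity_apply _ MeasurableSet.univ, setLIntegral_univ,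
    lintegral_trajDens]⟩

/-- The discounted total reward `∑_{t=0}^H γ^t R(s_t, a_t)` of a trajectory. -/
def totalReward (M : MDP S A) (τ : Traj S A M.horizon) : ℝ :=
  ∑ t : Fin (M.horizon + 1), M.γ ^ (t : ℕ) * M.reward (τ t).1 (τ t).2

/-- The objective `J(θ)`, the expected total reward under `π_θ`. -/
noncomputable def J (M : MDP S A) (π : PolicyClass S ν d) (θ : Param d) : ℝ :=
  ∫ τ, M.totalReward τ ∂(M.trajLaw π θ)

/-- The REINFORCE trajectory gradient with baseline `b`. -/
noncomputable def reinforce (M : MDP S A) (π : PolicyClass S ν d) (b : S → A → ℝ)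
    (θ : Param d) (τ : Traj S A M.horizon) : Param d :=
  (∑ t : Fin (M.horizon + 1), (M.γ ^ (t : ℕ) * M.reward (τ t).1 (τ t).2 - b (τ t).1 (τ t).2)) •
    ∑ t, π.score θ (τ t)

/-- The G(PO)MDP trajectory gradient with baseline `b`. -/
noncomputable def gpomdp (M : MDP S A) (π : PolicyClass S ν d) (b : S → A → ℝ)
    (θ : Param d) (τ : Traj S A M.horizon) : Param d :=
  ∑ t : Fin (M.horizon + 1), (M.γ ^ (t : ℕ) * M.reward (τ t).1 (τ t).2 - b (τ t).1 (τ t).2) •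
    ∑ i ∈ Finset.Iic t, π.score θ (τ i)

/-- `E_{τ ∼ p(· | θ₁)} |1 - ω(τ | θ₁, θ₂)|²`, the variance of the importance weight. -/
noncomputable def weightVar (M : MDP S A) (π : PolicyClass S ν d) (θ₁ θ₂ : Param d) : ℝ≥0∞ :=
  ∫⁻ τ, ENNReal.ofReal ((1 - π.weight θ₁ θ₂ τ) ^ 2) ∂(M.trajLaw π θ₁)

/-- The variance `E_{τ ∼ p(· | θ)} ‖g(τ | θ) - ∇J(θ)‖²` of the trajectory gradient. -/
noncomputable def gradVar (M : MDP S A) (π : PolicyClass S ν d)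
    (g : Param d → Traj S A M.horizon → Param d) (θ : Param d) : ℝ≥0∞ :=
  ∫⁻ τ, ENNReal.ofReal (‖g θ τ - gradient (M.J π) θ‖ ^ 2) ∂(M.trajLaw π θ)

/-- `L` is a Lipschitz constant of `∇J`, `Lg` one of `g(τ | ·)` for every trajectory `τ`, and
`Γ` bounds `‖g‖²`. -/
structure SmoothnessConsts (M : MDP S A) (π : PolicyClass S ν d)
    (g : Param d → Traj S A M.horizon → Param d) (L Lg Γ : ℝ) : Prop where
  L_pos : 0 < L
  Lg_nonneg : 0 ≤ Lg
  Γ_pos : 0 < Γ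
  gradient_lipschitz : ∀ θ₁ θ₂,
    ‖gradient (M.J π) θ₁ - gradient (M.J π) θ₂‖ ≤ L * ‖θ₁ - θ₂‖
  g_lipschitz : ∀ θ₁ θ₂ τ, ‖g θ₁ τ - g θ₂ τ‖ ≤ Lg * ‖θ₁ - θ₂‖
  g_bounded : ∀ θ τ, ‖g θ τ‖ ^ 2 ≤ Γ

/-- `C` is a positive constant with `Var ω(· | θ₁, θ₂) ≤ C ‖θ₁ - θ₂‖²` for all `θ₁, θ₂`. -/
structure WeightConst (M : MDP S A) (π : PolicyClass S ν d) (C : ℝ) : Prop where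
  pos : 0 < C
  weightVar_le : ∀ θ₁ θ₂, M.weightVar π θ₁ θ₂ ≤ ENNReal.ofReal (C * ‖θ₁ - θ₂‖ ^ 2)

end MDP

/-- The number of trajectories drawn at iteration `k`. At the start of an epoch (`k` a multiple of
`m`) it is `α σ² / ((β / m) ∑_{i=k-m}^{k-1} ‖v_i‖² + ε)`, rounded up; otherwise it is `B`.
For `k = 0` the index set `Finset.Ico (0 - m) 0` is empty, as it should be because the `v_i` with
negative index are `0`; any other multiple `k` of `m` is at least `m`. -/
noncomputable def batchSize {d : ℕ} (α β σ ε : ℝ) (m B : ℕ) (v : ℕ → Param d) (k : ℕ) : ℕ :=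
  if k % m = 0 then ⌈α * σ ^ 2 / (β / m * ∑ i ∈ Finset.Ico (k - m) k, ‖v i‖ ^ 2 + ε)⌉₊ else B

/-- The first iteration `n_k = ⌊k / m⌋ m` of the epoch that contains iteration `k`. -/
def epochStart (m k : ℕ) : ℕ := k / m * m

/-- A run of AbaSVRPG with iterations `0, …, K` on a probability space `(Ω, μ)`: `θ k` and `v k`
are the iterates and the gradient estimators, `τ k i` is the `i`-th trajectory drawn at iteration
`k`, `ξ` is the index of the output `θ_ξ`, and `ℱ k` contains the information available before
the trajectories of iteration `k` are drawn. -/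
structure IsAbaSVRPG {S A Ω : Type*} [MeasurableSpace S] [MeasurableSpace A]
    [mΩ : MeasurableSpace Ω] {ν : Measure A} {d : ℕ} (M : MDP S A) (π : PolicyClass S ν d)
    (g : Param d → Traj S A M.horizon → Param d) (θ₀ : Param d) (η ε σ α β : ℝ) (m B K : ℕ)
    (μ : Measure Ω) (ℱ : Filtration ℕ mΩ) (θ v : ℕ → Ω → Param d)
    (τ : ℕ → ℕ → Ω → Traj S A M.horizon) (ξ : Ω → Fin (K + 1)) : Prop where
  /-- the initial iterate is `θ₀` -/
  init : ∀ ω, θ 0 ω = θ₀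
  /-- the trajectories of iteration `k` are known after iteration `k` -/
  adapted : ∀ k ≤ K, ∀ i, Measurable[ℱ (k + 1)] (τ k i)
  /-- given the past, and given that `n` trajectories have to be drawn at iteration `k`, the
  trajectories `τ k 0, …, τ k (n - 1)` are independent with law `p(· | θ_k)` -/
  sampling : ∀ k ≤ K, ∀ (n : ℕ) (F : Set Ω), MeasurableSet[ℱ k] F →
    (∀ ω ∈ F, batchSize α β σ ε m B (fun i => v i ω) k = n) →
    ∀ C : Fin n → Set (Traj S A M.horizon), (∀ i, MeasurableSet (C i)) →
      μ (F ∩ {ω | ∀ i : Fin n, τ k i ω ∈ C i}) =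
        ∫⁻ ω in F, ∏ i : Fin n, M.trajLaw π (θ k ω) (C i) ∂μ
  /-- the estimator at the start of an epoch -/
  outer : ∀ k ≤ K, k % m = 0 → ∀ ω, v k ω =
    ((batchSize α β σ ε m B (fun i => v i ω) k : ℝ))⁻¹ •
      ∑ i ∈ Finset.range (batchSize α β σ ε m B (fun i => v i ω) k), g (θ k ω) (τ k i ω)
  /-- the estimator inside an epoch -/
  inner : ∀ k ≤ K, k % m ≠ 0 → ∀ ω, v k ω =
    (B : ℝ)⁻¹ • ∑ i ∈ Finset.range B,
      (g (θ k ω) (τ k i ω) -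
        π.weight (θ k ω) (θ (epochStart m k) ω) (τ k i ω) • g (θ (epochStart m k) ω) (τ k i ω))
      + v (epochStart m k) ω
  /-- the update -/
  update : ∀ k ≤ K, ∀ ω, θ (k + 1) ω = θ k ω + η • v k ω
  /-- the output index is uniform on `{0, …, K}` and independent of the iterates -/
  measurable_output : Measurable ξ
  uniform_output : ∀ k, μ (ξ ⁻¹' {k}) = ((K : ℝ≥0∞) + 1)⁻¹
  indep_output : IndepFun ξ (fun ω (k : Fin (K + 1)) => θ k ω) μ

end AbaPG

/-! ### Regularity of the score and of the importance weight -/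

namespace AbaPG

open Filter Topology

/-! The proof balances the ascent of `J` against the error of the estimator. For a function with
`L`-Lipschitz gradient and step `1/(2L)`, polarisation turns the quadratic lower bound into
`J(θ_{k+1}) - J(θ_k) ≥ (‖∇J(θ_k)‖² + ‖v_k‖²/2 - ‖v_k - ∇J(θ_k)‖²) / (4L)` (`ascent_step`). Summed
over `k`, the left side telescopes and is at most `J(θ*) - J(θ₀)`. It remains to absorb the expected
errors into `½ ∑ E‖v_k‖²`.

At an epoch start the batch size `N` is known before sampling, so the conditional variance is at
most `σ²/N`, and the rounding up in `N` makes this at most `((β/m) ∑ ‖v_i‖² + ε)/α`, with `i` in the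
previous epoch (`outer_error`). Inside an epoch the error is the average of `B` conditionally i.i.d.
centred vectors plus the error at the epoch start. The two are orthogonal because importance
sampling makes the correction unbiased. Its variance is at most `Q‖θ_k - θ_n‖²/B`, where `n` is the
epoch start, and the displacement is `η` times a sum of at most `m - 1` estimators, so
Cauchy-Schwarz applies (`inner_error`).

Double counting then bounds the total error by `(β/α + Q(m-1)²/(4L²B)) ∑ E‖v_i‖² + (K+1)ε/α`
(`sum_error_le`). Here `β/α = 1/8`, and the choice of `m` and `B` makes the second coefficient at
most `1/4` (`mul_sub_one_sq_le`). The sum `3/8` is below `1/2`, so the `v`-terms drop out.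

The constants exist because the weight is the exponential of a Lipschitz function of `θ`: at
distance at most one it differs from `1` by a multiple of the distance, and at larger distances
uniform bounds suffice. -/

/-- Expansion in the standard basis. The factor `d` is crude, but only finiteness of the resulting
constants matters. -/
theorem norm_le_of_single_le {d : ℕ} {E : Type*} [NormedAddCommGroup E] [NormedSpace ℝ E]
    (T : Param d →L[ℝ] E) {c : ℝ} (hc : 0 ≤ c)
    (h : ∀ i, ‖T (EuclideanSpace.single i 1)‖ ≤ c) : ‖T‖ ≤ d * c := by
  refine T.opNorm_le_bound (by positivity) fun w => ?_
  have hw : ∑ i, w i • EuclideanSpace.single i (1 : ℝ) = w := by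
    simpa using (EuclideanSpace.basisFun (Fin d) ℝ).sum_repr w
  calc ‖T w‖ = ‖∑ i, w i • T (EuclideanSpace.single i 1)‖ := by
        conv_lhs => rw [← hw]
        simp only [map_sum, map_smul]
    _ ≤ ∑ _i : Fin d, ‖w‖ * c := norm_sum_le_of_le _ fun i _ => by
        rw [norm_smul]
        exact mul_le_mul (PiLp.norm_apply_le w i) (h i) (norm_nonneg _) (norm_nonneg _)
    _ = d * c * ‖w‖ := by
        rw [Finset.sum_const, Finset.card_univ, Fintype.card_fin, nsmul_eq_mul]; ring

namespace PolicyClass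

variable {S A : Type*} [MeasurableSpace S] [MeasurableSpace A] {ν : Measure A} {d : ℕ}
  {π : PolicyClass S ν d} {G H : ℝ}

namespace BoundedLogDerivs

theorem norm_fderiv_le (h : π.BoundedLogDerivs G H) (s : S) (a : A) (θ : Param d) :
    ‖fderiv ℝ (π.logDens s a) θ‖ ≤ d * |G| :=
  norm_le_of_single_le _ (abs_nonneg _) fun i => (h.partial_le s a θ i).trans (le_abs_self _)

theorem norm_fderiv_fderiv_le (h : π.BoundedLogDerivs G H) (s : S) (a : A) (θ : Param d) :
    ‖fderiv ℝ (fderiv ℝ (π.logDens s a)) θ‖ ≤ d * (d * |H|) := by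
  refine norm_le_of_single_le _ (by positivity) fun i => ?_
  refine norm_le_of_single_le _ (abs_nonneg _) fun j => ?_
  refine le_trans (le_of_eq ?_) ((h.partial_partial_le s a θ i j).trans (le_abs_self _))
  rw [Real.norm_eq_abs]
  congr 1
  -- Evaluation at a fixed basis vector commutes with differentiation, so a mixed partial is an
  -- entry of the second Fréchet derivative.
  have := ((h.differentiable_fderiv s a θ).hasFDerivAt.clm_apply
    (hasFDerivAt_const (EuclideanSpace.single j (1 : ℝ)) θ)).fderiv
  rw [this]
  simp

theorem abs_logDens_sub_le (h : π.BoundedLogDerivs G H) (s : S) (a : A) (θ₁ θ₂ : Param d) :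
    |π.logDens s a θ₂ - π.logDens s a θ₁| ≤ d * |G| * ‖θ₁ - θ₂‖ := by
  rw [norm_sub_rev]
  exact Convex.norm_image_sub_le_of_norm_fderiv_le (𝕜 := ℝ)
    (fun x _ => h.differentiable s a x) (fun x _ => h.norm_fderiv_le s a x) convex_univ
    (Set.mem_univ _) (Set.mem_univ _)

theorem norm_score_le (h : π.BoundedLogDerivs G H) (θ : Param d) (x : S × A) :
    ‖π.score θ x‖ ≤ d * |G| := by
  rw [score, gradient, LinearIsometryEquiv.norm_map]
  exact h.norm_fderiv_le _ _ _

theorem norm_score_sub_le (h : π.BoundedLogDerivs G H) (θ₁ θ₂ : Param d) (x : S × A) :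
    ‖π.score θ₁ x - π.score θ₂ x‖ ≤ d * (d * |H|) * ‖θ₁ - θ₂‖ := by
  rw [score, score, gradient, gradient, ← map_sub, LinearIsometryEquiv.norm_map]
  exact Convex.norm_image_sub_le_of_norm_fderiv_le (𝕜 := ℝ)
    (fun y _ => h.differentiable_fderiv x.1 x.2 y)
    (fun y _ => h.norm_fderiv_fderiv_le x.1 x.2 y) convex_univ
    (Set.mem_univ _) (Set.mem_univ _)

/-- Each directional derivative is a pointwise limit of difference quotients with increment `w/n`,
which are measurable in the state and action; the basis expansion reassembles the gradient. -/
theorem measurable_score (h : π.BoundedLogDerivs G H) (θ : Param d) :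
    Measurable (π.score θ) := by
  have hm (θ : Param d) : Measurable fun x : S × A => π.logDens x.1 x.2 θ :=
    Real.measurable_log.comp (π.measurable_dens θ)
  have hpart (w : Param d) : Measurable fun x : S × A => fderiv ℝ (π.logDens x.1 x.2) θ w := by
    refine measurable_of_tendsto_metrizable (f := fun (n : ℕ) (x : S × A) =>
      (n : ℝ) * (π.logDens x.1 x.2 (θ + (n : ℝ)⁻¹ • w) - π.logDens x.1 x.2 θ))
      (fun n => ((hm _).sub (hm _)).const_mul _) ?_
    refine tendsto_pi_nhds.2 fun x => ?_
    refine (h.differentiable x.1 x.2 θ).hasFDerivAt.lim w ?_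
    exact tendsto_norm_atTop_atTop.comp tendsto_natCast_atTop_atTop
  have heq : π.score θ = fun x => ∑ i, fderiv ℝ (π.logDens x.1 x.2) θ
      (EuclideanSpace.single i 1) • EuclideanSpace.single i (1 : ℝ) := by
    funext x
    have := (EuclideanSpace.basisFun (Fin d) ℝ).sum_repr' (π.score θ x)
    rw [← this]
    refine Finset.sum_congr rfl fun i _ => ?_
    rw [real_inner_comm, score, gradient, InnerProductSpace.toDual_symm_apply]
    simp
  rw [heq]
  exact Finset.measurable_sum _ fun i _ => (hpart _).smul_const _

theorem continuous_dens (h : π.BoundedLogDerivs G H) (s : S) (a : A) :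
    Continuous fun θ => π.dens θ s a := by
  have : (fun θ => π.dens θ s a) = fun θ => Real.exp (π.logDens s a θ) := by
    funext θ
    rw [logDens, Real.exp_log (π.dens_pos θ s a)]
  rw [this]
  exact Real.continuous_exp.comp (h.differentiable s a).continuous

theorem continuous_trajDens (h : π.BoundedLogDerivs G H) {n : ℕ} (τ : Traj S A n) :
    Continuous fun θ => π.trajDens θ τ :=
  continuous_finsetProd _ fun _ _ => h.continuous_dens _ _

end BoundedLogDerivs

theorem trajDens_pos (π : PolicyClass S ν d) {n : ℕ} (θ : Param d) (τ : Traj S A n) :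
    0 < π.trajDens θ τ :=
  Finset.prod_pos fun _ _ => π.dens_pos _ _ _

theorem weight_pos (π : PolicyClass S ν d) {n : ℕ} (θ₁ θ₂ : Param d) (τ : Traj S A n) :
    0 < π.weight θ₁ θ₂ τ :=
  div_pos (π.trajDens_pos _ _) (π.trajDens_pos _ _)

theorem weight_eq_exp (π : PolicyClass S ν d) {n : ℕ} (θ₁ θ₂ : Param d) (τ : Traj S A n) :
    π.weight θ₁ θ₂ τ =
      Real.exp (∑ t, (π.logDens (τ t).1 (τ t).2 θ₂ - π.logDens (τ t).1 (τ t).2 θ₁)) := by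
  rw [Real.exp_sum, weight, trajDens, trajDens, ← Finset.prod_div_distrib]
  refine Finset.prod_congr rfl fun t _ => ?_
  rw [Real.exp_sub, logDens, logDens, Real.exp_log (π.dens_pos _ _ _),
    Real.exp_log (π.dens_pos _ _ _)]

theorem measurable_weight (π : PolicyClass S ν d) {n : ℕ} (θ₁ θ₂ : Param d) :
    Measurable (π.weight θ₁ θ₂ : Traj S A n → ℝ) :=
  (MDP.measurable_trajDens π n θ₂).div (MDP.measurable_trajDens π n θ₁)

/-- For `x ≥ 0`, multiply `1 - x ≤ exp (-x)` by `exp x`; for `x ≤ 0`, already `1 - exp x ≤ |x|`. -/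
theorem _root_.Real.abs_one_sub_exp_le (x : ℝ) : |1 - Real.exp x| ≤ |x| * Real.exp |x| := by
  have h1 := Real.add_one_le_exp x
  have h2 := Real.add_one_le_exp (-x)
  have h3 : Real.exp x * Real.exp (-x) = 1 := by rw [← Real.exp_add]; simp
  have h4 : 1 ≤ Real.exp |x| := Real.one_le_exp (abs_nonneg _)
  rw [abs_le]
  rcases le_total 0 x with hx | hx
  · rw [abs_of_nonneg hx]
    constructor <;> nlinarith [Real.exp_pos x]
  · have h5 : Real.exp x ≤ 1 := Real.exp_le_one_iff.2 hx
    have h6 : 0 ≤ |x| * Real.exp |x| := by positivity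
    refine ⟨by linarith, ?_⟩
    have : |x| ≤ |x| * Real.exp |x| := le_mul_of_one_le_right (abs_nonneg _) h4
    rw [abs_of_nonpos hx] at this ⊢
    linarith

/-- For parameters at distance at most one, the importance weight differs from `1` by at most a
multiple of the distance. -/
theorem BoundedLogDerivs.exists_abs_one_sub_weight_le (h : π.BoundedLogDerivs G H) (n : ℕ) :
    ∃ c : ℝ, 0 ≤ c ∧ ∀ (θ₁ θ₂ : Param d) (τ : Traj S A n), ‖θ₁ - θ₂‖ ≤ 1 →
      |1 - π.weight θ₁ θ₂ τ| ≤ c * ‖θ₁ - θ₂‖ := by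
  set c : ℝ := (n + 1) * (d * |G|) with hc
  have hc0 : 0 ≤ c := by positivity
  refine ⟨c * Real.exp c, by positivity, fun θ₁ θ₂ τ hθ => ?_⟩
  set x := ∑ t, (π.logDens (τ t).1 (τ t).2 θ₂ - π.logDens (τ t).1 (τ t).2 θ₁) with hx
  have hxc : |x| ≤ c * ‖θ₁ - θ₂‖ := by
    refine (Finset.abs_sum_le_sum_abs _ _).trans
      ((Finset.sum_le_sum fun t _ => h.abs_logDens_sub_le _ _ θ₁ θ₂).trans (le_of_eq ?_))
    rw [Finset.sum_const, Finset.card_univ, Fintype.card_fin, nsmul_eq_mul, hc]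
    push_cast
    ring
  have hxc' : |x| ≤ c := hxc.trans (mul_le_of_le_one_right hc0 hθ)
  rw [weight_eq_exp, ← hx]
  calc |1 - Real.exp x| ≤ |x| * Real.exp |x| := Real.abs_one_sub_exp_le x
    _ ≤ (c * ‖θ₁ - θ₂‖) * Real.exp c := by gcongr
    _ = c * Real.exp c * ‖θ₁ - θ₂‖ := by ring

end PolicyClass

/-! ### Trajectory laws and existence of the constants -/

namespace MDP

variable {S A : Type*} [MeasurableSpace S] [MeasurableSpace A] {ν : Measure A} {d : ℕ}
  {M : MDP S A} {π : PolicyClass S ν d}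

/-- The trajectory laws as a kernel from the parameters to the trajectories. -/
noncomputable def trajKernel (M : MDP S A) [SigmaFinite ν] (π : PolicyClass S ν d) :
    Kernel (Param d) (Traj S A M.horizon) :=
  (Kernel.const (Param d) (M.refMeasure ν M.horizon)).withDensity
    fun θ τ => ENNReal.ofReal (π.trajDens θ τ)

/-- Continuity in `θ` and measurability in `τ` give joint measurability of the density. Without it
`Kernel.withDensity` takes its default value `0`. -/
theorem trajKernel_apply [SigmaFinite ν]
    (hc : ∀ τ : Traj S A M.horizon, Continuous fun θ => π.trajDens θ τ) (θ : Param d) :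
    M.trajKernel π θ = M.trajLaw π θ := by
  have : Measurable (Function.uncurry fun (θ : Param d) (τ : Traj S A M.horizon) =>
      ENNReal.ofReal (π.trajDens θ τ)) :=
    measurable_uncurry_of_continuous_of_measurable
      (fun τ => ENNReal.continuous_ofReal.comp (hc τ))
      fun θ => (measurable_trajDens π _ θ).ennreal_ofReal
  rw [trajKernel, Kernel.withDensity_apply _ this, Kernel.const_apply, trajLaw]

theorem integral_trajLaw {E : Type*} [NormedAddCommGroup E] [NormedSpace ℝ E] (θ : Param d)
    (f : Traj S A M.horizon → E) :
    ∫ τ, f τ ∂(M.trajLaw π θ) = ∫ τ, π.trajDens θ τ • f τ ∂(M.refMeasure ν M.horizon) := by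
  rw [trajLaw, integral_withDensity_eq_integral_toReal_smul
    (measurable_trajDens π _ θ).ennreal_ofReal (ae_of_all _ fun _ => ENNReal.ofReal_lt_top)]
  refine integral_congr_ae (ae_of_all _ fun τ => ?_)
  simp [ENNReal.toReal_ofReal (π.trajDens_pos θ τ).le]

/-- Importance sampling: a change of the trajectory law by the weight. -/
theorem integral_weight_smul {E : Type*} [NormedAddCommGroup E] [NormedSpace ℝ E]
    (θ₁ θ₂ : Param d) (f : Traj S A M.horizon → E) :
    ∫ τ, π.weight θ₁ θ₂ τ • f τ ∂(M.trajLaw π θ₁) = ∫ τ, f τ ∂(M.trajLaw π θ₂) := by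
  rw [integral_trajLaw, integral_trajLaw]
  refine integral_congr_ae (ae_of_all _ fun τ => ?_)
  simp only [smul_smul]
  rw [PolicyClass.weight, mul_div_cancel₀ _ (π.trajDens_pos θ₁ τ).ne']

/-- A common form for both estimators, so that measurability and bounds are proved once: they differ
only in which scores each reward multiplies. -/
theorem exists_eq_sum_smul_sum {b : S → A → ℝ} {g : Param d → Traj S A M.horizon → Param d}
    (hg : g = M.reinforce π b ∨ g = M.gpomdp π b) :
    ∃ I : Fin (M.horizon + 1) → Finset (Fin (M.horizon + 1)), ∀ θ τ, g θ τ =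
      ∑ t : Fin (M.horizon + 1),
        (M.γ ^ (t : ℕ) * M.reward (τ t).1 (τ t).2 - b (τ t).1 (τ t).2) •
          ∑ i ∈ I t, π.score θ (τ i) := by
  rcases hg with rfl | rfl
  · exact ⟨fun _ => Finset.univ, fun θ τ => by rw [reinforce, Finset.sum_smul]⟩
  · exact ⟨fun t => Finset.Iic t, fun θ τ => rfl⟩

theorem abs_γ_pow_mul_le (M : MDP S A) {r R : ℝ} (hr : |r| ≤ R) (t : ℕ) :
    |M.γ ^ t * r| ≤ R := by
  rw [abs_mul, abs_of_nonneg (pow_nonneg M.γ_nonneg t)]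
  exact (mul_le_of_le_one_left (abs_nonneg _) (pow_le_one₀ M.γ_nonneg M.γ_lt_one.le)).trans hr

theorem abs_totalReward_le {R : ℝ} (hR : ∀ s a, |M.reward s a| ≤ R)
    (τ : Traj S A M.horizon) : |M.totalReward τ| ≤ (M.horizon + 1) * R := by
  refine (Finset.abs_sum_le_sum_abs _ _).trans ((Finset.sum_le_sum fun t _ =>
    M.abs_γ_pow_mul_le (hR (τ t).1 (τ t).2) (t : ℕ)).trans (le_of_eq ?_))
  simp

theorem abs_J_le [SigmaFinite ν] {R : ℝ} (hR : ∀ s a, |M.reward s a| ≤ R) (θ : Param d) :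
    |M.J π θ| ≤ (M.horizon + 1) * R := by
  have := norm_integral_le_of_norm_le_const (μ := M.trajLaw π θ) (f := M.totalReward)
    (ae_of_all _ fun τ => abs_totalReward_le (M := M) hR τ)
  simpa [J] using this

section Gradient

variable {b : S → A → ℝ} {g : Param d → Traj S A M.horizon → Param d} {G H R : ℝ}

theorem measurable_g (hb : Measurable (Function.uncurry b))
    (hg : g = M.reinforce π b ∨ g = M.gpomdp π b) (h_log : π.BoundedLogDerivs G H)
    (θ : Param d) : Measurable (g θ) := by
  obtain ⟨I, hI⟩ := exists_eq_sum_smul_sum hg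
  rw [show g θ = _ from funext (hI θ)]
  refine Finset.measurable_sum _ fun t _ => Measurable.fun_smul ?_ ?_
  · exact ((M.measurable_reward.comp (measurable_pi_apply t)).const_mul _).sub
      (hb.comp (measurable_pi_apply t))
  · exact Finset.measurable_sum _ fun i _ =>
      (h_log.measurable_score θ).comp (measurable_pi_apply i)

theorem norm_sum_smul_sum_le {n : ℕ} {E : Type*} [NormedAddCommGroup E] [NormedSpace ℝ E]
    (c : Fin n → ℝ) (I : Fin n → Finset (Fin n)) (x : Fin n → E) {C X : ℝ}
    (hC : ∀ t, |c t| ≤ C) (hX : ∀ i, ‖x i‖ ≤ X) (hX0 : 0 ≤ X) :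
    ‖∑ t, c t • ∑ i ∈ I t, x i‖ ≤ n * (C * (n * X)) := by
  refine (norm_sum_le_of_le _ fun t _ => ?_).trans
    (le_of_eq (by rw [Finset.sum_const, Finset.card_univ, Fintype.card_fin, nsmul_eq_mul]))
  rw [norm_smul]
  refine mul_le_mul (hC t) ?_ (norm_nonneg _) ((abs_nonneg _).trans (hC t))
  refine (norm_sum_le_of_le _ fun i _ => hX i).trans ?_
  rw [Finset.sum_const, nsmul_eq_mul]
  have : ((I t).card : ℝ) ≤ n := by
    exact_mod_cast (Finset.card_le_univ _).trans (by simp)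
  gcongr

theorem exists_norm_g_bounds (hb : ∃ C : ℝ, ∀ s a, |b s a| ≤ C)
    (hg : g = M.reinforce π b ∨ g = M.gpomdp π b) (h_reward : ∀ s a, |M.reward s a| ≤ R)
    (h_log : π.BoundedLogDerivs G H) :
    ∃ D Lg : ℝ, 0 ≤ D ∧ 0 ≤ Lg ∧ (∀ θ τ, ‖g θ τ‖ ≤ D) ∧
      ∀ θ₁ θ₂ τ, ‖g θ₁ τ - g θ₂ τ‖ ≤ Lg * ‖θ₁ - θ₂‖ := by
  obtain ⟨C, hC⟩ := hb
  obtain ⟨I, hI⟩ := exists_eq_sum_smul_sum hg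
  have hcoef (τ : Traj S A M.horizon) (t : Fin (M.horizon + 1)) :
      |M.γ ^ (t : ℕ) * M.reward (τ t).1 (τ t).2 - b (τ t).1 (τ t).2| ≤ |R| + |C| :=
    (abs_sub _ _).trans (add_le_add
      (M.abs_γ_pow_mul_le ((h_reward _ _).trans (le_abs_self _)) t)
      ((hC _ _).trans (le_abs_self _)))
  refine ⟨(M.horizon + 1 : ℕ) * ((|R| + |C|) * ((M.horizon + 1 : ℕ) * (d * |G|))),
    (M.horizon + 1 : ℕ) * ((|R| + |C|) * ((M.horizon + 1 : ℕ) * (d * (d * |H|)))),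
    by positivity, by positivity, fun θ τ => ?_, fun θ₁ θ₂ τ => ?_⟩
  · rw [hI]
    exact norm_sum_smul_sum_le _ I _ (hcoef τ) (fun i => h_log.norm_score_le θ (τ i))
      (by positivity)
  · rw [hI, hI, ← Finset.sum_sub_distrib]
    simp only [← smul_sub, ← Finset.sum_sub_distrib]
    refine (norm_sum_smul_sum_le _ I _ (hcoef τ)
      (fun i => h_log.norm_score_sub_le θ₁ θ₂ (τ i)) (by positivity)).trans (le_of_eq ?_)
    ring

/-- Importance sampling writes `∇J(θ₁) - ∇J(θ₂)` as the mean of `g(θ₁) - ω g(θ₂)` under the single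
law `p(· | θ₁)`, so `J` need not be differentiated twice. -/
theorem exists_smoothnessConsts [SigmaFinite ν] (hb_meas : Measurable (Function.uncurry b))
    (hb : ∃ C : ℝ, ∀ s a, |b s a| ≤ C)
    (hg : g = M.reinforce π b ∨ g = M.gpomdp π b)
    (h_unbiased : ∀ θ, HasGradientAt (M.J π) (∫ τ, g θ τ ∂(M.trajLaw π θ)) θ)
    (h_reward : ∀ s a, |M.reward s a| ≤ R) (h_log : π.BoundedLogDerivs G H) :
    ∃ L Lg Γ : ℝ, M.SmoothnessConsts π g L Lg Γ := by
  obtain ⟨D, Lg, hD0, hLg0, hD, hLg⟩ := exists_norm_g_bounds hb hg h_reward h_log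
  obtain ⟨c, hc0, hc⟩ := h_log.exists_abs_one_sub_weight_le M.horizon
  have hmeas (θ : Param d) : Measurable (g θ) := measurable_g hb_meas hg h_log θ
  have hint (θ θ' : Param d) : Integrable (g θ) (M.trajLaw π θ') :=
    Integrable.of_bound (hmeas θ).aestronglyMeasurable D (ae_of_all _ (hD θ))
  have hgrad (θ : Param d) : gradient (M.J π) θ = ∫ τ, g θ τ ∂(M.trajLaw π θ) :=
    (h_unbiased θ).gradient
  -- `Lg + c * D` serves distances up to one, `2 * D` larger distances; each `+ 1` ensures
  -- positivity.
  refine ⟨Lg + c * D + 2 * D + 1, Lg, D ^ 2 + 1, by positivity, hLg0, by positivity,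
    fun θ₁ θ₂ => ?_, hLg, fun θ τ => ?_⟩
  · rcases le_total ‖θ₁ - θ₂‖ 1 with hθ | hθ
    · have key (τ : Traj S A M.horizon) :
          ‖g θ₁ τ - π.weight θ₁ θ₂ τ • g θ₂ τ‖ ≤ (Lg + c * D) * ‖θ₁ - θ₂‖ := by
        have : g θ₁ τ - π.weight θ₁ θ₂ τ • g θ₂ τ
            = (g θ₁ τ - g θ₂ τ) + (1 - π.weight θ₁ θ₂ τ) • g θ₂ τ := by
          rw [sub_smul, one_smul]; abel
        rw [this]
        refine (norm_add_le _ _).trans ?_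
        rw [norm_smul, add_mul, mul_right_comm]
        exact add_le_add (hLg _ _ _)
          (mul_le_mul (hc _ _ _ hθ) (hD _ _) (norm_nonneg _) (by positivity))
      have hw : Integrable (fun τ => π.weight θ₁ θ₂ τ • g θ₂ τ) (M.trajLaw π θ₁) := by
        refine Integrable.of_bound
          ((π.measurable_weight θ₁ θ₂).smul (hmeas θ₂)).aestronglyMeasurable ((1 + c) * D)
          (ae_of_all _ fun τ => ?_)
        rw [norm_smul]
        refine mul_le_mul ?_ (hD _ _) (norm_nonneg _) (by positivity)
        have h1 := (hc θ₁ θ₂ τ hθ).trans (mul_le_of_le_one_right hc0 hθ)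
        have h2 := abs_le.1 h1
        rw [Real.norm_eq_abs, abs_of_pos (π.weight_pos _ _ _)]
        linarith
      rw [hgrad, hgrad, ← integral_weight_smul θ₁ θ₂, ← integral_sub (hint _ _) hw]
      refine (norm_integral_le_of_norm_le_const (ae_of_all _ key)).trans ?_
      rw [probReal_univ, mul_one]
      exact mul_le_mul_of_nonneg_right (by linarith) (norm_nonneg _)
    · have hJ (θ : Param d) : ‖gradient (M.J π) θ‖ ≤ D := by
        rw [hgrad]
        simpa using norm_integral_le_of_norm_le_const (μ := M.trajLaw π θ)
          (ae_of_all _ (hD θ))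
      calc ‖gradient (M.J π) θ₁ - gradient (M.J π) θ₂‖ ≤ D + D :=
            (norm_sub_le _ _).trans (add_le_add (hJ _) (hJ _))
        _ ≤ (Lg + c * D + 2 * D + 1) * 1 := by nlinarith [mul_nonneg hc0 hD0]
        _ ≤ _ := by gcongr
  · have := pow_le_pow_left₀ (norm_nonneg _) (hD θ τ) 2
    linarith

end Gradient

/-- At distance at most one the pointwise bound on the weight is squared; beyond that `W ≤ |W| ‖θ₁ -
θ₂‖²`. -/
theorem exists_weightConst [SigmaFinite ν] {G H : ℝ} (h_log : π.BoundedLogDerivs G H)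
    (hW : ∃ W : ℝ, ∀ θ₁ θ₂, M.weightVar π θ₁ θ₂ ≤ ENNReal.ofReal W) :
    ∃ C : ℝ, M.WeightConst π C := by
  obtain ⟨W, hW⟩ := hW
  obtain ⟨c, hc0, hc⟩ := h_log.exists_abs_one_sub_weight_le M.horizon
  refine ⟨c ^ 2 + |W| + 1, by positivity, fun θ₁ θ₂ => ?_⟩
  rcases le_total ‖θ₁ - θ₂‖ 1 with hθ | hθ
  · have key (τ : Traj S A M.horizon) : ENNReal.ofReal ((1 - π.weight θ₁ θ₂ τ) ^ 2) ≤
        ENNReal.ofReal ((c ^ 2 + |W| + 1) * ‖θ₁ - θ₂‖ ^ 2) := by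
      refine ENNReal.ofReal_le_ofReal ?_
      rw [← sq_abs]
      refine (pow_le_pow_left₀ (abs_nonneg _) (hc _ _ _ hθ) 2).trans ?_
      rw [mul_pow]
      gcongr
      linarith [abs_nonneg W]
    refine (lintegral_mono key).trans ?_
    rw [lintegral_const, measure_univ, mul_one]
  · refine (hW θ₁ θ₂).trans (ENNReal.ofReal_le_ofReal ?_)
    calc W ≤ (c ^ 2 + |W| + 1) * 1 := by linarith [le_abs_self W, sq_nonneg c]
      _ ≤ _ := by
        gcongr
        exact one_le_pow₀ hθ

end MDP

end AbaPG

namespace AbaPG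

/-! ### Second moments under conditionally i.i.d. sampling -/

section CondIID

variable {Ω E T : Type*} [MeasurableSpace Ω] [MeasurableSpace E] [MeasurableSpace T]

/-- Given `Z`, the variables `X 0, …, X (n - 1)` are independent with law `κ Z`. -/
def CondIID (m : Measure Ω) (Z : Ω → E) (κ : Kernel E T) (n : ℕ) (X : ℕ → Ω → T) : Prop :=
  ∀ s, MeasurableSet s → ∀ C : Fin n → Set T, (∀ i, MeasurableSet (C i)) →
    m (Z ⁻¹' s ∩ {ω | ∀ i : Fin n, X i ω ∈ C i}) = ∫⁻ ω in Z ⁻¹' s, ∏ i, κ (Z ω) (C i) ∂m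

variable {m : Measure Ω} [IsFiniteMeasure m] {Z : Ω → E} {κ : Kernel E T} [IsMarkovKernel κ]
  {n : ℕ} {X : ℕ → Ω → T}

/-- Rectangles determine the joint law, and the unused coordinates are tested against the whole
space. Pairs suffice because second moments involve two samples at a time. -/
theorem CondIID.map_prod (h : CondIID m Z κ n X) (hZ : Measurable Z)
    (hX : ∀ i, Measurable (X i)) {i j : ℕ} (hi : i < n) (hj : j < n) (hij : i ≠ j) :
    m.map (fun ω => (Z ω, X i ω, X j ω)) = (m.map Z) ⊗ₘ (κ ×ₖ κ) := by
  have : IsFiniteMeasure (m.map fun ω => (Z ω, X i ω, X j ω)) :=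
    Measure.isFiniteMeasure_map _ _
  refine Measure.ext_prod₃ fun {s t u} hs ht hu => ?_
  have hm : Measurable fun ω => (Z ω, X i ω, X j ω) := hZ.prodMk ((hX i).prodMk (hX j))
  rw [Measure.map_apply hm (hs.prod (ht.prod hu)),
    Measure.compProd_apply_prod hs (ht.prod hu),
    setLIntegral_map hs (Kernel.measurable_coe _ (ht.prod hu)) hZ]
  have hij' : (⟨i, hi⟩ : Fin n) ≠ ⟨j, hj⟩ := fun h => hij (Fin.mk.inj_iff.1 h)
  have key := h s hs
    (fun k => (if k = ⟨i, hi⟩ then t else Set.univ) ∩ if k = ⟨j, hj⟩ then u else Set.univ)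
    (fun k => by split_ifs <;> simp [ht, hu, ht.inter hu])
  convert! key using 1
  · congr 1
    ext ω
    simp only [Set.mem_preimage, Set.mem_prod, Set.mem_inter_iff, Set.mem_ofPred_eq]
    refine and_congr_right fun _ => ⟨fun h k => ?_, fun h => ⟨?_, ?_⟩⟩
    · split_ifs with h1 h2 h2
      · exact absurd (h1.symm.trans h2) hij'
      · subst h1; exact ⟨h.1, trivial⟩
      · subst h2; exact ⟨trivial, h.2⟩
      · exact ⟨trivial, trivial⟩
    · simpa using (h ⟨i, hi⟩).1
    · simpa using (h ⟨j, hj⟩).2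
  · refine lintegral_congr fun ω => ?_
    rw [Kernel.prod_apply, Measure.prod_prod]
    have hk (k : Fin n) : κ (Z ω)
        ((if k = ⟨i, hi⟩ then t else Set.univ) ∩ if k = ⟨j, hj⟩ then u else Set.univ) =
        (if k = ⟨i, hi⟩ then κ (Z ω) t else 1) * if k = ⟨j, hj⟩ then κ (Z ω) u else 1 := by
      split_ifs with h1 h2 h2
      · exact absurd (h1.symm.trans h2) hij'
      all_goals simp
    simp only [hk, Finset.prod_mul_distrib, Finset.prod_ite_eq', Finset.mem_univ, if_true]

theorem CondIID.map_single (h : CondIID m Z κ n X) (hZ : Measurable Z)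
    (hX : ∀ i, Measurable (X i)) {i : ℕ} (hi : i < n) :
    m.map (fun ω => (Z ω, X i ω)) = (m.map Z) ⊗ₘ κ := by
  have : IsFiniteMeasure (m.map fun ω => (Z ω, X i ω)) := Measure.isFiniteMeasure_map _ _
  refine Measure.ext_prod fun {s t} hs ht => ?_
  rw [Measure.map_apply (hZ.prodMk (hX i)) (hs.prod ht), Measure.compProd_apply_prod hs ht,
    setLIntegral_map hs (Kernel.measurable_coe _ ht) hZ]
  have key := h s hs (fun k => if k = ⟨i, hi⟩ then t else Set.univ)
    (fun k => by split_ifs <;> simp [ht])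
  convert! key using 1
  · congr 1
    ext ω
    simp only [Set.mem_preimage, Set.mem_prod, Set.mem_inter_iff, Set.mem_ofPred_eq]
    refine and_congr_right fun _ => ⟨fun h k => ?_, fun h => ?_⟩
    · split_ifs with h1
      · subst h1; exact h
      · trivial
    · simpa using h ⟨i, hi⟩
  · refine lintegral_congr fun ω => ?_
    have hk (k : Fin n) : κ (Z ω) (if k = ⟨i, hi⟩ then t else Set.univ) =
        if k = ⟨i, hi⟩ then κ (Z ω) t else 1 := by
      split_ifs <;> simp
    simp only [hk, Finset.prod_ite_eq', Finset.mem_univ, if_true]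


theorem memLp_two_of_lintegral_le {α : Type*} [MeasurableSpace α] {μ : Measure α} {V : Type*}
    [NormedAddCommGroup V] {f : α → V}
    (hf : AEStronglyMeasurable f μ) {c : ℝ≥0∞} (hc : c ≠ ∞)
    (h : ∫⁻ x, ENNReal.ofReal (‖f x‖ ^ 2) ∂μ ≤ c) : MemLp f 2 μ := by
  rw [memLp_two_iff_integrable_sq_norm hf]
  refine ⟨(hf.norm.pow 2), ?_⟩
  rw [hasFiniteIntegral_iff_ofReal (ae_of_all _ fun x => sq_nonneg _)]
  exact h.trans_lt hc.lt_top

variable {V : Type*} [NormedAddCommGroup V] [MeasurableSpace V] [BorelSpace V]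
  [SecondCountableTopology V]

/-- Disintegrating a nonnegative integral needs no integrability, so the conditional bound yields
membership in `L²` and the estimate together. -/
theorem CondIID.memLp_and_integral_le (hX' : CondIID m Z κ n X) (hZ : Measurable Z)
    (hX : ∀ i, Measurable (X i)) {h : E × T → V} (hh : Measurable h) {v : E → ℝ}
    (hv : ∀ z, ∫⁻ t, ENNReal.ofReal (‖h (z, t)‖ ^ 2) ∂κ z ≤ ENNReal.ofReal (v z))
    (hv0 : ∀ z, 0 ≤ v z) (hvi : Integrable (fun ω => v (Z ω)) m) {i : ℕ} (hi : i < n) :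
    MemLp (fun ω => h (Z ω, X i ω)) 2 m ∧
      ∫ ω, ‖h (Z ω, X i ω)‖ ^ 2 ∂m ≤ ∫ ω, v (Z ω) ∂m := by
  have hmeas : Measurable fun ω => h (Z ω, X i ω) := hh.comp (hZ.prodMk (hX i))
  have hh2 : Measurable fun q : E × T => ENNReal.ofReal (‖h q‖ ^ 2) :=
    (hh.norm.pow_const 2).ennreal_ofReal
  have hle : ∫⁻ ω, ENNReal.ofReal (‖h (Z ω, X i ω)‖ ^ 2) ∂m ≤
      ENNReal.ofReal (∫ ω, v (Z ω) ∂m) := by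
    rw [ofReal_integral_eq_lintegral_ofReal hvi (ae_of_all _ fun ω => hv0 _)]
    calc ∫⁻ ω, ENNReal.ofReal (‖h (Z ω, X i ω)‖ ^ 2) ∂m
        = ∫⁻ q, ENNReal.ofReal (‖h q‖ ^ 2) ∂(m.map fun ω => (Z ω, X i ω)) :=
          (lintegral_map hh2 (hZ.prodMk (hX i))).symm
      _ = ∫⁻ ω, ∫⁻ t, ENNReal.ofReal (‖h (Z ω, t)‖ ^ 2) ∂κ (Z ω) ∂m := by
          rw [hX'.map_single hZ hX hi, Measure.lintegral_compProd hh2,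
            lintegral_map hh2.lintegral_kernel_prod_right' hZ]
      _ ≤ _ := lintegral_mono fun ω => hv (Z ω)
  have hL := memLp_two_of_lintegral_le hmeas.aestronglyMeasurable ENNReal.ofReal_ne_top hle
  refine ⟨hL, ?_⟩
  rw [← ofReal_integral_eq_lintegral_ofReal hL.norm.integrable_sq
    (ae_of_all _ fun ω => sq_nonneg _)] at hle
  exact (ENNReal.ofReal_le_ofReal_iff (integral_nonneg fun ω => hv0 _)).1 hle

open scoped InnerProductSpace

theorem _root_.MeasureTheory.MemLp.integrable_inner_of_two {α V : Type*} [MeasurableSpace α]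
    [NormedAddCommGroup V] [InnerProductSpace ℝ V]
    {μ : Measure α} {f g : α → V} (hf : MemLp f 2 μ) (hg : MemLp g 2 μ) :
    Integrable (fun x => ⟪f x, g x⟫_ℝ) μ := by
  refine Integrable.mono' (hf.norm.integrable_mul hg.norm)
    (hf.aestronglyMeasurable.inner hg.aestronglyMeasurable) (ae_of_all _ fun x => ?_)
  exact norm_inner_le_norm _ _

variable [InnerProductSpace ℝ V] [CompleteSpace V]

/-- Given `Z`, the vector `W Z` is constant and the conditional mean of the other factor is zero. -/
theorem CondIID.integral_inner_right_eq_zero (hX' : CondIID m Z κ n X) (hZ : Measurable Z)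
    (hX : ∀ i, Measurable (X i)) {h : E × T → V} (hh : Measurable h)
    (hint : ∀ z, Integrable (fun t => h (z, t)) (κ z)) (h0 : ∀ z, ∫ t, h (z, t) ∂κ z = 0)
    {W : E → V} (hW : Measurable W) {i : ℕ} (hi : i < n)
    (hL : MemLp (fun ω => h (Z ω, X i ω)) 2 m) (hWL : MemLp (fun ω => W (Z ω)) 2 m) :
    ∫ ω, ⟪W (Z ω), h (Z ω, X i ω)⟫_ℝ ∂m = 0 := by
  have hf : Measurable fun q : E × T => ⟪W q.1, h q⟫_ℝ := (hW.comp measurable_fst).inner hh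
  have hp : Measurable fun ω => (Z ω, X i ω) := hZ.prodMk (hX i)
  have hI := hWL.integrable_inner_of_two hL
  have hI' : Integrable (fun q : E × T => ⟪W q.1, h q⟫_ℝ) ((m.map Z) ⊗ₘ κ) := by
    rw [← hX'.map_single hZ hX hi]
    exact (integrable_map_measure hf.aestronglyMeasurable hp.aemeasurable).2 hI
  calc ∫ ω, ⟪W (Z ω), h (Z ω, X i ω)⟫_ℝ ∂m
      = ∫ q, ⟪W q.1, h q⟫_ℝ ∂(m.map fun ω => (Z ω, X i ω)) :=
        (integral_map hp.aemeasurable hf.aestronglyMeasurable).symm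
    _ = ∫ z, ∫ t, ⟪W z, h (z, t)⟫_ℝ ∂κ z ∂(m.map Z) := by
        rw [hX'.map_single hZ hX hi, Measure.integral_compProd hI']
    _ = 0 := by
        simp only [integral_inner (hint _), h0, inner_zero_right, integral_zero]

theorem CondIID.integral_inner_eq_zero (hX' : CondIID m Z κ n X) (hZ : Measurable Z)
    (hX : ∀ i, Measurable (X i)) {h : E × T → V} (hh : Measurable h)
    (hint : ∀ z, Integrable (fun t => h (z, t)) (κ z)) (h0 : ∀ z, ∫ t, h (z, t) ∂κ z = 0)
    {i j : ℕ} (hi : i < n) (hj : j < n) (hij : i ≠ j)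
    (hLi : MemLp (fun ω => h (Z ω, X i ω)) 2 m) (hLj : MemLp (fun ω => h (Z ω, X j ω)) 2 m) :
    ∫ ω, ⟪h (Z ω, X i ω), h (Z ω, X j ω)⟫_ℝ ∂m = 0 := by
  have hf : Measurable fun q : E × T × T => ⟪h (q.1, q.2.1), h (q.1, q.2.2)⟫_ℝ :=
    (hh.comp (measurable_fst.prodMk measurable_snd.fst)).inner
      (hh.comp (measurable_fst.prodMk measurable_snd.snd))
  have hp : Measurable fun ω => (Z ω, X i ω, X j ω) := hZ.prodMk ((hX i).prodMk (hX j))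
  have hI := hLi.integrable_inner_of_two hLj
  have hI' : Integrable (fun q : E × T × T => ⟪h (q.1, q.2.1), h (q.1, q.2.2)⟫_ℝ)
      ((m.map Z) ⊗ₘ (κ ×ₖ κ)) := by
    rw [← hX'.map_prod hZ hX hi hj hij]
    exact (integrable_map_measure hf.aestronglyMeasurable hp.aemeasurable).2 hI
  calc ∫ ω, ⟪h (Z ω, X i ω), h (Z ω, X j ω)⟫_ℝ ∂m
      = ∫ q, ⟪h (q.1, q.2.1), h (q.1, q.2.2)⟫_ℝ ∂(m.map fun ω => (Z ω, X i ω, X j ω)) :=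
        (integral_map hp.aemeasurable hf.aestronglyMeasurable).symm
    _ = ∫ z, ∫ q, ⟪h (z, q.1), h (z, q.2)⟫_ℝ ∂((κ ×ₖ κ) z) ∂(m.map Z) := by
        rw [hX'.map_prod hZ hX hi hj hij, Measure.integral_compProd hI']
    _ = ∫ _z, (0 : ℝ) ∂(m.map Z) := by
        refine integral_congr_ae (ae_of_all _ fun z => ?_)
        simp only [Kernel.prod_apply]
        by_cases hz : Integrable (fun q : T × T => ⟪h (z, q.1), h (z, q.2)⟫_ℝ)
            ((κ z).prod (κ z))
        · rw [integral_prod _ hz]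
          simp only [integral_inner (hint _), h0, inner_zero_right, integral_zero]
        -- A slice that is not integrable has Bochner integral `0` by default, which is the value
        -- required.
        · exact integral_undef hz
    _ = 0 := integral_zero _ _

/-- The second moment of the average of conditionally i.i.d. centred vectors, plus a vector that
is determined by the conditioning. -/
theorem CondIID.memLp_average_add (hX' : CondIID m Z κ n X) (hn : 0 < n) (hZ : Measurable Z)
    (hX : ∀ i, Measurable (X i)) {h : E × T → V} (hh : Measurable h)
    (h0 : ∀ z, ∫ t, h (z, t) ∂κ z = 0) {v : E → ℝ}
    (hv : ∀ z, ∫⁻ t, ENNReal.ofReal (‖h (z, t)‖ ^ 2) ∂κ z ≤ ENNReal.ofReal (v z))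
    (hv0 : ∀ z, 0 ≤ v z) (hvi : Integrable (fun ω => v (Z ω)) m)
    {W : E → V} (hW : Measurable W) (hWL : MemLp (fun ω => W (Z ω)) 2 m) :
    MemLp (fun ω => (n : ℝ)⁻¹ • ∑ i ∈ Finset.range n, h (Z ω, X i ω) + W (Z ω)) 2 m ∧
      ∫ ω, ‖(n : ℝ)⁻¹ • ∑ i ∈ Finset.range n, h (Z ω, X i ω) + W (Z ω)‖ ^ 2 ∂m ≤
        (n : ℝ)⁻¹ * ∫ ω, v (Z ω) ∂m + ∫ ω, ‖W (Z ω)‖ ^ 2 ∂m := by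
  have hint (z : E) : Integrable (fun t => h (z, t)) (κ z) :=
    (memLp_two_of_lintegral_le (hh.comp measurable_prodMk_left).aestronglyMeasurable
      ENNReal.ofReal_ne_top (hv z)).integrable (by norm_num)
  have hL {i : ℕ} (hi : i ∈ Finset.range n) : MemLp (fun ω => h (Z ω, X i ω)) 2 m :=
    (hX'.memLp_and_integral_le hZ hX hh hv hv0 hvi (Finset.mem_range.1 hi)).1
  have hsum : MemLp (fun ω => ∑ i ∈ Finset.range n, h (Z ω, X i ω)) 2 m :=
    memLp_finsetSum _ fun i hi => hL hi
  refine ⟨(hsum.const_smul (n : ℝ)⁻¹).add hWL, ?_⟩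
  have hexp (ω : Ω) : ‖(n : ℝ)⁻¹ • ∑ i ∈ Finset.range n, h (Z ω, X i ω) + W (Z ω)‖ ^ 2 =
      ((n : ℝ)⁻¹ ^ 2 * (∑ i ∈ Finset.range n, ∑ j ∈ Finset.range n,
        ⟪h (Z ω, X i ω), h (Z ω, X j ω)⟫_ℝ) +
      2 * (n : ℝ)⁻¹ * ∑ i ∈ Finset.range n, ⟪W (Z ω), h (Z ω, X i ω)⟫_ℝ) + ‖W (Z ω)‖ ^ 2 := by
    have h1 : ‖∑ i ∈ Finset.range n, h (Z ω, X i ω)‖ ^ 2 = ∑ i ∈ Finset.range n,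
        ∑ j ∈ Finset.range n, ⟪h (Z ω, X i ω), h (Z ω, X j ω)⟫_ℝ := by
      rw [← real_inner_self_eq_norm_sq, sum_inner]
      simp only [inner_sum]
    have h2 : ⟪∑ i ∈ Finset.range n, h (Z ω, X i ω), W (Z ω)⟫_ℝ =
        ∑ i ∈ Finset.range n, ⟪W (Z ω), h (Z ω, X i ω)⟫_ℝ := by
      rw [real_inner_comm, inner_sum]
    rw [norm_add_sq_real, norm_smul, mul_pow, h1, real_inner_smul_left, h2, Real.norm_eq_abs,
      sq_abs]
    ring
  have hI1 : Integrable (fun ω => ∑ i ∈ Finset.range n, ∑ j ∈ Finset.range n,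
      ⟪h (Z ω, X i ω), h (Z ω, X j ω)⟫_ℝ) m :=
    integrable_finsetSum _ fun i hi => integrable_finsetSum _ fun j hj =>
      (hL hi).integrable_inner_of_two (hL hj)
  have hI2 : Integrable (fun ω => ∑ i ∈ Finset.range n, ⟪W (Z ω), h (Z ω, X i ω)⟫_ℝ) m :=
    integrable_finsetSum _ fun i hi => hWL.integrable_inner_of_two (hL hi)
  have hI12 : Integrable (fun ω => (n : ℝ)⁻¹ ^ 2 * (∑ i ∈ Finset.range n,
      ∑ j ∈ Finset.range n, ⟪h (Z ω, X i ω), h (Z ω, X j ω)⟫_ℝ) +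
      2 * (n : ℝ)⁻¹ * ∑ i ∈ Finset.range n, ⟪W (Z ω), h (Z ω, X i ω)⟫_ℝ) m :=
    (hI1.const_mul _).add (hI2.const_mul _)
  simp only [hexp]
  rw [integral_add hI12 hWL.norm.integrable_sq,
    integral_add (hI1.const_mul _) (hI2.const_mul _), integral_const_mul, integral_const_mul,
    integral_finsetSum _ fun i hi => hWL.integrable_inner_of_two (hL hi),
    Finset.sum_eq_zero fun i hi => hX'.integral_inner_right_eq_zero hZ hX hh hint h0 hW
      (Finset.mem_range.1 hi) (hL hi) hWL, mul_zero, add_zero,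
    integral_finsetSum _ fun i hi => integrable_finsetSum _ fun j hj =>
      (hL hi).integrable_inner_of_two (hL hj)]
  -- Off-diagonal terms vanish; the `n` diagonal ones turn the factor `n⁻²` into `n⁻¹`.
  have hdiag : ∑ i ∈ Finset.range n, ∫ ω, ∑ j ∈ Finset.range n,
      ⟪h (Z ω, X i ω), h (Z ω, X j ω)⟫_ℝ ∂m ≤ ∑ i ∈ Finset.range n, ∫ ω, v (Z ω) ∂m := by
    refine Finset.sum_le_sum fun i hi => ?_
    rw [integral_finsetSum _ fun j hj => (hL hi).integrable_inner_of_two (hL hj),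
      Finset.sum_eq_single_of_mem i hi fun j hj hji => hX'.integral_inner_eq_zero hZ hX hh hint h0
        (Finset.mem_range.1 hi) (Finset.mem_range.1 hj) hji.symm (hL hi) (hL hj)]
    simp only [real_inner_self_eq_norm_sq]
    exact (hX'.memLp_and_integral_le hZ hX hh hv hv0 hvi (Finset.mem_range.1 hi)).2
  rw [Finset.sum_const, Finset.card_range, nsmul_eq_mul] at hdiag
  have hn' : (0 : ℝ) < n := by exact_mod_cast hn
  refine add_le_add_left ((mul_le_mul_of_nonneg_left hdiag (by positivity)).trans
    (le_of_eq ?_)) _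
  field_simp

end CondIID

end AbaPG

namespace AbaPG

open scoped InnerProductSpace

/-! ### Ascent inequality and auxiliary integral estimates -/

section Ascent

variable {E : Type*} [NormedAddCommGroup E] [InnerProductSpace ℝ E] [CompleteSpace E]
  {f : E → ℝ} {L : ℝ}

/-- The quadratic lower bound for a function with Lipschitz gradient. -/
theorem add_inner_sub_le_of_gradient_lipschitz (hf : Differentiable ℝ f)
    (hL : ∀ x y, ‖gradient f x - gradient f y‖ ≤ L * ‖x - y‖) (x u : E) :
    f x + ⟪gradient f x, u⟫_ℝ - L / 2 * ‖u‖ ^ 2 ≤ f (x + u) := by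
  -- The quadratic term compensates the variation of the gradient along the segment, so `φ` is
  -- nondecreasing on `[0, 1]`; `φ 0 ≤ φ 1` is the claim.
  let φ : ℝ → ℝ := fun t =>
    f (x + t • u) - t * ⟪gradient f x, u⟫_ℝ + L / 2 * t ^ 2 * ‖u‖ ^ 2
  have hφ (t : ℝ) : HasDerivAt φ
      (⟪gradient f (x + t • u), u⟫_ℝ - ⟪gradient f x, u⟫_ℝ + L * t * ‖u‖ ^ 2) t := by
    have hline : HasDerivAt (fun t : ℝ => x + t • u) u t := by
      simpa using ((hasDerivAt_id t).smul_const u).const_add x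
    have h1 : HasDerivAt (fun t : ℝ => f (x + t • u)) ⟪gradient f (x + t • u), u⟫_ℝ t := by
      have := ((hf (x + t • u)).hasGradientAt.hasFDerivAt).comp_hasDerivAt t hline
      simpa [Function.comp_def] using this
    have h2 := (hasDerivAt_id t).mul_const ⟪gradient f x, u⟫_ℝ
    have h3 := (((hasDerivAt_id t).pow 2).const_mul (L / 2)).mul_const (‖u‖ ^ 2)
    refine ((h1.sub h2).add h3).congr_deriv ?_
    simp only [id_eq]
    ring
  have hmono : MonotoneOn φ (Set.Icc 0 1) := by
    refine monotoneOn_of_deriv_nonneg (convex_Icc _ _)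
      (fun t _ => (hφ t).continuousAt.continuousWithinAt)
      (fun t _ => (hφ t).differentiableAt.differentiableWithinAt) fun t ht => ?_
    rw [interior_Icc] at ht
    rw [(hφ t).deriv, ← inner_sub_left]
    have h1 := abs_le.1 (abs_real_inner_le_norm (gradient f (x + t • u) - gradient f x) u)
    have h2 := hL (x + t • u) x
    rw [add_sub_cancel_left, norm_smul, Real.norm_of_nonneg ht.1.le] at h2
    nlinarith [mul_le_mul_of_nonneg_right h2 (norm_nonneg u)]
  have := hmono (Set.left_mem_Icc.2 zero_le_one) (Set.right_mem_Icc.2 zero_le_one) zero_le_one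
  simp only [φ, zero_smul, add_zero, one_smul] at this
  linarith

/-- The quadratic bound with `u = v/(2L)`, its inner product rewritten by polarisation; that
rewriting is an identity, so nothing is lost there. -/
theorem ascent_step (hf : Differentiable ℝ f) (hL0 : 0 < L)
    (hL : ∀ x y, ‖gradient f x - gradient f y‖ ≤ L * ‖x - y‖) (x v : E) :
    f x + 1 / (4 * L) * ‖gradient f x‖ ^ 2 + 1 / (8 * L) * ‖v‖ ^ 2
      - 1 / (4 * L) * ‖v - gradient f x‖ ^ 2 ≤ f (x + (1 / (2 * L)) • v) := by
  refine le_trans (le_of_eq ?_)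
    (add_inner_sub_le_of_gradient_lipschitz hf hL x ((1 / (2 * L)) • v))
  rw [norm_sub_sq_real, real_inner_smul_right, norm_smul, mul_pow, real_inner_comm,
    Real.norm_eq_abs, sq_abs]
  field_simp
  ring

end Ascent

/-- Centring removes `‖E f‖²` from the second moment. -/
theorem lintegral_sub_integral_le {α V : Type*} [MeasurableSpace α] {μ : Measure α}
    [IsProbabilityMeasure μ] [NormedAddCommGroup V] [InnerProductSpace ℝ V] [CompleteSpace V]
    {f : α → V} (hf : MemLp f 2 μ) :
    ∫⁻ x, ENNReal.ofReal (‖f x - ∫ y, f y ∂μ‖ ^ 2) ∂μ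
      ≤ ∫⁻ x, ENNReal.ofReal (‖f x‖ ^ 2) ∂μ := by
  have hfi : Integrable f μ := hf.integrable (by norm_num)
  set c := ∫ y, f y ∂μ with hc
  have hfc : MemLp (fun x => f x - c) 2 μ := hf.sub (memLp_const c)
  have hin : Integrable (fun x => 2 * ⟪c, f x⟫_ℝ) μ := (hfi.const_inner c).const_mul 2
  rw [← ofReal_integral_eq_lintegral_ofReal hfc.norm.integrable_sq
      (ae_of_all _ fun x => sq_nonneg _),
    ← ofReal_integral_eq_lintegral_ofReal hf.norm.integrable_sq
      (ae_of_all _ fun x => sq_nonneg _)]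
  refine ENNReal.ofReal_le_ofReal ?_
  have hexp (x : α) : ‖f x - c‖ ^ 2 = ‖f x‖ ^ 2 - 2 * ⟪c, f x⟫_ℝ + ‖c‖ ^ 2 := by
    rw [norm_sub_sq_real, real_inner_comm]
  have hI : Integrable (fun x => ‖f x‖ ^ 2 - 2 * ⟪c, f x⟫_ℝ) μ :=
    hf.norm.integrable_sq.sub hin
  simp only [hexp]
  rw [integral_add hI (integrable_const _), integral_sub hf.norm.integrable_sq hin,
    integral_const_mul, integral_inner hfi, ← hc, real_inner_self_eq_norm_sq, integral_const,
    probReal_univ, one_smul]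
  nlinarith [sq_nonneg ‖c‖]

/-- Meant for a random batch size: on each fibre the number of samples is a constant. -/
theorem integral_le_integral_of_fiber {Ω : Type*} [MeasurableSpace Ω] {μ : Measure Ω}
    {N : Ω → ℕ} (hN : Measurable N) {f g : Ω → ℝ} (hf : Integrable f μ) (hg : Integrable g μ)
    (h : ∀ n, ∫ ω in N ⁻¹' {n}, f ω ∂μ ≤ ∫ ω in N ⁻¹' {n}, g ω ∂μ) :
    ∫ ω, f ω ∂μ ≤ ∫ ω, g ω ∂μ := by
  have hm (n : ℕ) : MeasurableSet (N ⁻¹' {n}) := hN (measurableSet_singleton n)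
  have hd : Pairwise (Function.onFun Disjoint fun n => N ⁻¹' {n}) := fun i j hij =>
    Disjoint.preimage _ (by simpa using hij)
  have hU : ⋃ n, N ⁻¹' {n} = Set.univ := by ext ω; simp
  have h1 := hasSum_integral_iUnion hm hd (f := f) hf.integrableOn
  have h2 := hasSum_integral_iUnion hm hd (f := g) hg.integrableOn
  rw [hU, setIntegral_univ] at h1 h2
  exact hasSum_le h h1 h2

theorem measurable_average {Ω V : Type*} {mΩ : MeasurableSpace Ω} [NormedAddCommGroup V]
    [NormedSpace ℝ V] [MeasurableSpace V] [BorelSpace V] [SecondCountableTopology V]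
    {N : Ω → ℕ} (hN : Measurable N) {Y : ℕ → Ω → V} (hY : ∀ i, Measurable (Y i)) :
    Measurable fun ω => (N ω : ℝ)⁻¹ • ∑ i ∈ Finset.range (N ω), Y i ω := by
  have h : Measurable fun q : ℕ × Ω => (q.1 : ℝ)⁻¹ • ∑ i ∈ Finset.range q.1, Y i q.2 :=
    measurable_from_prod_countable_right fun n =>
      Measurable.fun_smul (f := fun _ : Ω => (n : ℝ)⁻¹) measurable_const
        (Finset.measurable_sum (Finset.range n) fun i _ => hY i)
  exact h.comp (hN.prodMk measurable_id)

/-! ### Double counting over epochs and choice of parameters -/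

section Epochs

/-- If `i` lies in the window before the start of the epoch of `k`, then `k` lies in the epoch after
that of `i`, which has `m` indices. -/
theorem card_filter_prevEpoch_le {m : ℕ} (hm : 0 < m) (K i : ℕ) :
    ((Finset.range K).filter fun k => epochStart m k - m ≤ i ∧ i < epochStart m k).card ≤ m := by
  have hsub : ((Finset.range K).filter fun k => epochStart m k - m ≤ i ∧ i < epochStart m k) ⊆
      Finset.Ico ((i / m + 1) * m) ((i / m + 1) * m + m) := by
    intro k hk
    obtain ⟨-, h1, h2⟩ := Finset.mem_filter.1 hk
    unfold epochStart at h1 h2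
    -- The first epoch starts at `0`, so no `i` precedes it.
    obtain ⟨q, hq⟩ : ∃ q, k / m = q + 1 :=
      Nat.exists_eq_succ_of_ne_zero fun h0 => by simp [h0] at h2
    rw [hq, add_mul, one_mul] at h1 h2
    have hi : i / m = q := Nat.div_eq_of_lt_le (by omega) (by rw [add_mul]; omega)
    have hk1 := Nat.div_mul_le_self k m
    have hk2 := Nat.lt_div_mul_add (a := k) hm
    rw [hq] at hk1 hk2
    rw [hi, Finset.mem_Ico]
    exact ⟨hk1, hk2⟩
  exact (Finset.card_le_card hsub).trans (by simp)

/-- Such `k` lie in the epoch of `i`, strictly after `i`: at most `m - 1` of them. -/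
theorem card_filter_laterInEpoch_le {m : ℕ} (hm : 0 < m) (K i : ℕ) :
    ((Finset.range K).filter fun k => epochStart m k ≤ i ∧ i < k).card ≤ m - 1 := by
  have hsub : ((Finset.range K).filter fun k => epochStart m k ≤ i ∧ i < k) ⊆
      Finset.Ico (i + 1) (i / m * m + m) := by
    intro k hk
    obtain ⟨-, h1, h2⟩ := Finset.mem_filter.1 hk
    unfold epochStart at h1
    have hk2 := Nat.lt_div_mul_add (a := k) hm
    have hi : i / m = k / m := Nat.div_eq_of_lt_le h1 (by rw [add_mul]; omega)
    rw [hi, Finset.mem_Ico]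
    omega
  refine (Finset.card_le_card hsub).trans ?_
  rw [Nat.card_Ico]
  have := Nat.div_mul_le_self i m
  omega

theorem sum_sum_le_of_card_le {n c : ℕ} {A : ℕ → ℝ} (hA : ∀ i, 0 ≤ A i)
    (s : ℕ → Finset ℕ) (P : ℕ → ℕ → Prop) [∀ k, DecidablePred (P k)]
    (hs : ∀ k ∈ Finset.range n, ∀ i ∈ s k, i < n ∧ P k i)
    (hc : ∀ i, ((Finset.range n).filter fun k => P k i).card ≤ c) :
    ∑ k ∈ Finset.range n, ∑ i ∈ s k, A i ≤ c * ∑ i ∈ Finset.range n, A i := by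
  calc ∑ k ∈ Finset.range n, ∑ i ∈ s k, A i
      ≤ ∑ k ∈ Finset.range n, ∑ i ∈ (Finset.range n).filter (P k), A i :=
        Finset.sum_le_sum fun k hk => Finset.sum_le_sum_of_subset_of_nonneg
          (fun i hi => by simpa using hs k hk i hi) fun i _ _ => hA i
    _ = ∑ i ∈ Finset.range n, ∑ _k ∈ (Finset.range n).filter (fun k => P k i), A i := by
        simp only [Finset.sum_filter]
        exact Finset.sum_comm
    _ ≤ ∑ i ∈ Finset.range n, c * A i := Finset.sum_le_sum fun i _ => by
        rw [Finset.sum_const, nsmul_eq_mul]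
        exact mul_le_mul_of_nonneg_right (by exact_mod_cast hc i) (hA i)
    _ = _ := by rw [Finset.mul_sum]

theorem epochStart_le (m k : ℕ) : epochStart m k ≤ k := Nat.div_mul_le_self k m

/-- Summation of the error recursion over all iterations. -/
theorem sum_error_le {m n : ℕ} (hm : 0 < m) {A e : ℕ → ℝ} (hA : ∀ i, 0 ≤ A i) {a c δ : ℝ}
    (ha : 0 ≤ a) (hc : 0 ≤ c)
    (he : ∀ k < n, e k ≤ a / m * ∑ i ∈ Finset.Ico (epochStart m k - m) (epochStart m k), A i + δ
      + c * (((k - epochStart m k : ℕ) : ℝ) * ∑ i ∈ Finset.Ico (epochStart m k) k, A i)) :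
    ∑ k ∈ Finset.range n, e k ≤
      (a + c * ((m : ℝ) - 1) ^ 2) * ∑ i ∈ Finset.range n, A i + n * δ := by
  have hm' : (0 : ℝ) < m := by exact_mod_cast hm
  have hcast : ((m - 1 : ℕ) : ℝ) = (m : ℝ) - 1 := by rw [Nat.cast_sub hm, Nat.cast_one]
  have h1 : ∑ k ∈ Finset.range n, ∑ i ∈ Finset.Ico (epochStart m k - m) (epochStart m k), A i
      ≤ m * ∑ i ∈ Finset.range n, A i :=
    sum_sum_le_of_card_le hA _ (fun k i => epochStart m k - m ≤ i ∧ i < epochStart m k)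
      (fun k hk i hi => by
        rw [Finset.mem_Ico] at hi
        rw [Finset.mem_range] at hk
        exact ⟨hi.2.trans_le ((epochStart_le m k).trans hk.le), hi⟩)
      (card_filter_prevEpoch_le hm n)
  have h2 : ∑ k ∈ Finset.range n, ∑ i ∈ Finset.Ico (epochStart m k) k, A i
      ≤ (m - 1 : ℕ) * ∑ i ∈ Finset.range n, A i :=
    sum_sum_le_of_card_le hA _ (fun k i => epochStart m k ≤ i ∧ i < k)
      (fun k hk i hi => by
        rw [Finset.mem_Ico] at hi
        rw [Finset.mem_range] at hk
        exact ⟨hi.2.trans hk, hi⟩)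
      (card_filter_laterInEpoch_le hm n)
  have h3 (k : ℕ) : ((k - epochStart m k : ℕ) : ℝ) ≤ (m : ℝ) - 1 := by
    rw [← hcast]
    have := Nat.lt_div_mul_add (a := k) hm
    exact_mod_cast (show k - epochStart m k ≤ m - 1 by unfold epochStart; omega)
  have h4 : (0 : ℝ) ≤ (m : ℝ) - 1 := by rw [← hcast]; positivity
  calc ∑ k ∈ Finset.range n, e k
      ≤ ∑ k ∈ Finset.range n,
        (a / m * ∑ i ∈ Finset.Ico (epochStart m k - m) (epochStart m k), A i + δ
          + c * (((m : ℝ) - 1) * ∑ i ∈ Finset.Ico (epochStart m k) k, A i)) := by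
        refine Finset.sum_le_sum fun k hk => (he k (Finset.mem_range.1 hk)).trans ?_
        have : 0 ≤ ∑ i ∈ Finset.Ico (epochStart m k) k, A i := Finset.sum_nonneg fun i _ => hA i
        gcongr
        exact h3 k
    _ = a / m * (∑ k ∈ Finset.range n,
          ∑ i ∈ Finset.Ico (epochStart m k - m) (epochStart m k), A i) + n * δ
        + c * (((m : ℝ) - 1) * ∑ k ∈ Finset.range n,
          ∑ i ∈ Finset.Ico (epochStart m k) k, A i) := by
        simp only [Finset.sum_add_distrib, Finset.mul_sum, Finset.sum_const, Finset.card_range,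
          nsmul_eq_mul]
    -- The multiplicity `m` cancels the division in `a / m`. The second `m - 1` is a multiplicity,
    -- the first bounds the Cauchy-Schwarz factor `k - epochStart m k`.
    _ ≤ a / m * (m * ∑ i ∈ Finset.range n, A i) + n * δ
        + c * (((m : ℝ) - 1) * (((m : ℝ) - 1) * ∑ i ∈ Finset.range n, A i)) := by
        rw [hcast] at h2
        gcongr
    _ = _ := by field_simp; ring

/-- The choice of the epoch length and of the batch size inside an epoch. -/
theorem mul_sub_one_sq_le {L σ Q ε : ℝ} (hL : 0 < L) (hσ : 0 < σ) (hQ : 0 < Q) (hε : 0 < ε)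
    {m : ℕ} (hm : 0 < m) (hmx : |(m : ℝ) - (L ^ 2 * σ ^ 2 / (Q * ε)) ^ (1 / 3 : ℝ)| < 1) :
    Q * ((m : ℝ) - 1) ^ 2 ≤ L ^ 2 * ⌈(Q * σ ^ 4 / (L ^ 2 * ε ^ 2)) ^ (1 / 3 : ℝ)⌉₊ := by
  have cube {t : ℝ} (ht : 0 < t) : (t ^ (1 / 3 : ℝ)) ^ 3 = t := by
    rw [← Real.rpow_natCast, ← Real.rpow_mul ht.le]; norm_num
  set x := (L ^ 2 * σ ^ 2 / (Q * ε)) ^ (1 / 3 : ℝ) with hx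
  set y := (Q * σ ^ 4 / (L ^ 2 * ε ^ 2)) ^ (1 / 3 : ℝ) with hy
  have hx3 : x ^ 3 = L ^ 2 * σ ^ 2 / (Q * ε) := cube (by positivity)
  have hy3 : y ^ 3 = Q * σ ^ 4 / (L ^ 2 * ε ^ 2) := cube (by positivity)
  have hx0 : 0 ≤ x := by positivity
  have hy0 : 0 ≤ y := by positivity
  -- The unrounded choices balance exactly: both sides have cube `Q L⁴ σ⁴ / ε²`.
  have hxy : Q * x ^ 2 = L ^ 2 * y := by
    refine (pow_left_inj₀ (by positivity) (by positivity) (n := 3) (by norm_num)).1 ?_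
    rw [mul_pow, mul_pow, ← pow_mul, mul_comm 2 3, pow_mul, hx3, hy3]
    field_simp
  have hm1 : (1 : ℝ) ≤ m := by exact_mod_cast hm
  -- Since `m - 1` rather than `m` enters the bound, rounding up is harmless.
  have hmx' : (m : ℝ) - 1 ≤ x := by linarith [(abs_lt.1 hmx).2]
  calc Q * ((m : ℝ) - 1) ^ 2 ≤ Q * x ^ 2 := by
        have : (0 : ℝ) ≤ (m : ℝ) - 1 := by linarith
        gcongr
    _ = L ^ 2 * y := hxy
    _ ≤ _ := by gcongr; exact Nat.le_ceil y

end Epochs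

end AbaPG

/-! ### The gradient oracle and the measurability of a run -/

namespace AbaPG

open scoped InnerProductSpace

variable {S A : Type*} [MeasurableSpace S] [MeasurableSpace A] {ν : Measure A} {d : ℕ}
  {M : MDP S A} {π : PolicyClass S ν d} {g : Param d → Traj S A M.horizon → Param d}
  {σ L Lg Γ C : ℝ}

/-- The properties of a trajectory gradient that the convergence analysis uses. -/
structure GradientOracle (M : MDP S A) (π : PolicyClass S ν d)
    (g : Param d → Traj S A M.horizon → Param d) (σ L Lg Γ C : ℝ) : Prop where
  smooth : M.SmoothnessConsts π g L Lg Γ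
  weight : M.WeightConst π C
  continuous_trajDens : ∀ τ : Traj S A M.horizon, Continuous fun θ => π.trajDens θ τ
  measurable : ∀ θ, Measurable (g θ)
  hasGradientAt : ∀ θ, HasGradientAt (M.J π) (∫ τ, g θ τ ∂(M.trajLaw π θ)) θ
  gradVar_le : ∀ θ, M.gradVar π g θ ≤ ENNReal.ofReal (σ ^ 2)
  exists_abs_J_le : ∃ D, ∀ θ, |M.J π θ| ≤ D

namespace GradientOracle

variable (O : GradientOracle M π g σ L Lg Γ C)
include O

theorem gradient_eq (θ : Param d) : gradient (M.J π) θ = ∫ τ, g θ τ ∂(M.trajLaw π θ) :=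
  (O.hasGradientAt θ).gradient

theorem differentiable : Differentiable ℝ (M.J π) :=
  fun θ => (O.hasGradientAt θ).differentiableAt

theorem norm_g_le (θ : Param d) (τ : Traj S A M.horizon) : ‖g θ τ‖ ≤ √Γ :=
  Real.le_sqrt_of_sq_le (O.smooth.g_bounded θ τ)

theorem norm_gradient_le [SigmaFinite ν] (θ : Param d) : ‖gradient (M.J π) θ‖ ≤ √Γ := by
  rw [O.gradient_eq]
  simpa using norm_integral_le_of_norm_le_const (μ := M.trajLaw π θ)
    (ae_of_all _ (O.norm_g_le θ))

theorem measurable_gradient : Measurable (gradient (M.J π)) := by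
  refine (LipschitzWith.of_dist_le_mul (K := L.toNNReal) fun x y => ?_).continuous.measurable
  rw [dist_eq_norm, dist_eq_norm, Real.coe_toNNReal _ O.smooth.L_pos.le]
  exact O.smooth.gradient_lipschitz x y

theorem measurable_uncurry : Measurable (Function.uncurry g) := by
  refine measurable_uncurry_of_continuous_of_measurable (fun τ => ?_) O.measurable
  refine (LipschitzWith.of_dist_le_mul (K := Lg.toNNReal) fun x y => ?_).continuous
  rw [dist_eq_norm, dist_eq_norm, Real.coe_toNNReal _ O.smooth.Lg_nonneg]
  exact O.smooth.g_lipschitz x y τ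

theorem measurable_uncurry_trajDens :
    Measurable (Function.uncurry fun (θ : Param d) (τ : Traj S A M.horizon) => π.trajDens θ τ) :=
  measurable_uncurry_of_continuous_of_measurable O.continuous_trajDens
    fun θ => MDP.measurable_trajDens π _ θ

theorem measurable_weight {α : Type*} {_ : MeasurableSpace α} {a b : α → Param d}
    {τ : α → Traj S A M.horizon} (ha : Measurable a) (hb : Measurable b) (hτ : Measurable τ) :
    Measurable fun x => π.weight (a x) (b x) (τ x) :=
  (O.measurable_uncurry_trajDens.comp (hb.prodMk hτ)).div
    (O.measurable_uncurry_trajDens.comp (ha.prodMk hτ))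

theorem measurable_g_comp {α : Type*} {_ : MeasurableSpace α} {a : α → Param d}
    {τ : α → Traj S A M.horizon} (ha : Measurable a) (hτ : Measurable τ) :
    Measurable fun x => g (a x) (τ x) :=
  O.measurable_uncurry.comp (ha.prodMk hτ)

theorem isMarkovKernel [SigmaFinite ν] : IsMarkovKernel (M.trajKernel π) :=
  ⟨fun θ => by rw [MDP.trajKernel_apply O.continuous_trajDens]; infer_instance⟩

theorem integrable_g [SigmaFinite ν] (θ θ' : Param d) : Integrable (g θ) (M.trajLaw π θ') :=
  Integrable.of_bound (O.measurable θ).aestronglyMeasurable (√Γ) (ae_of_all _ (O.norm_g_le θ))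

/-- The second moment of the gradient difference with importance weight. -/
theorem lintegral_sq_norm_diff_le [SigmaFinite ν] (θ₁ θ₂ : Param d) :
    ∫⁻ τ, ENNReal.ofReal (‖g θ₁ τ - π.weight θ₁ θ₂ τ • g θ₂ τ‖ ^ 2) ∂(M.trajLaw π θ₁) ≤
      ENNReal.ofReal (2 * (Lg ^ 2 + Γ * C) * ‖θ₁ - θ₂‖ ^ 2) := by
  have hΓ := O.smooth.Γ_pos
  have hC := O.weight.pos
  have key (τ : Traj S A M.horizon) :
      ENNReal.ofReal (‖g θ₁ τ - π.weight θ₁ θ₂ τ • g θ₂ τ‖ ^ 2) ≤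
        ENNReal.ofReal (2 * Lg ^ 2 * ‖θ₁ - θ₂‖ ^ 2) +
          ENNReal.ofReal (2 * Γ) * ENNReal.ofReal ((1 - π.weight θ₁ θ₂ τ) ^ 2) := by
    rw [← ENNReal.ofReal_mul (by positivity),
      ← ENNReal.ofReal_add (by positivity) (by positivity)]
    refine ENNReal.ofReal_le_ofReal ?_
    have h1 : g θ₁ τ - π.weight θ₁ θ₂ τ • g θ₂ τ
        = (g θ₁ τ - g θ₂ τ) + (1 - π.weight θ₁ θ₂ τ) • g θ₂ τ := by
      rw [sub_smul, one_smul]; abel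
    have h2 := norm_add_le (g θ₁ τ - g θ₂ τ) ((1 - π.weight θ₁ θ₂ τ) • g θ₂ τ)
    have h3 := pow_le_pow_left₀ (norm_nonneg _) (O.smooth.g_lipschitz θ₁ θ₂ τ) 2
    have h4 : ‖(1 - π.weight θ₁ θ₂ τ) • g θ₂ τ‖ ^ 2 ≤ (1 - π.weight θ₁ θ₂ τ) ^ 2 * Γ := by
      rw [norm_smul, mul_pow, Real.norm_eq_abs, sq_abs]
      exact mul_le_mul_of_nonneg_left (O.smooth.g_bounded θ₂ τ) (sq_nonneg _)
    rw [h1]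
    have h5 := pow_le_pow_left₀ (norm_nonneg _) h2 2
    have h6 := add_sq_le (a := ‖g θ₁ τ - g θ₂ τ‖) (b := ‖(1 - π.weight θ₁ θ₂ τ) • g θ₂ τ‖)
    rw [mul_pow] at h3
    linarith
  refine (lintegral_mono key).trans ?_
  have hwm : Measurable fun τ : Traj S A M.horizon =>
      ENNReal.ofReal ((1 - π.weight θ₁ θ₂ τ) ^ 2) :=
    ((measurable_const.sub (π.measurable_weight θ₁ θ₂)).pow_const 2).ennreal_ofReal
  rw [lintegral_add_left measurable_const, lintegral_const_mul _ hwm, lintegral_const]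
  · rw [show 2 * (Lg ^ 2 + Γ * C) * ‖θ₁ - θ₂‖ ^ 2 =
        2 * Lg ^ 2 * ‖θ₁ - θ₂‖ ^ 2 + 2 * Γ * (C * ‖θ₁ - θ₂‖ ^ 2) by ring,
      ENNReal.ofReal_add (by positivity) (by positivity),
      ENNReal.ofReal_mul (p := 2 * Γ) (by positivity)]
    exact add_le_add (by simp) (mul_le_mul_right (O.weight.weightVar_le θ₁ θ₂) _)

theorem measurable_diff (θ₁ θ₂ : Param d) :
    Measurable fun τ => g θ₁ τ - π.weight θ₁ θ₂ τ • g θ₂ τ :=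
  (O.measurable θ₁).sub ((π.measurable_weight θ₁ θ₂).fun_smul (O.measurable θ₂))

theorem memLp_diff [SigmaFinite ν] (θ₁ θ₂ : Param d) :
    MemLp (fun τ => g θ₁ τ - π.weight θ₁ θ₂ τ • g θ₂ τ) 2 (M.trajLaw π θ₁) :=
  memLp_two_of_lintegral_le (O.measurable_diff θ₁ θ₂).aestronglyMeasurable
    ENNReal.ofReal_ne_top (O.lintegral_sq_norm_diff_le θ₁ θ₂)

theorem integral_diff [SigmaFinite ν] (θ₁ θ₂ : Param d) :
    ∫ τ, (g θ₁ τ - π.weight θ₁ θ₂ τ • g θ₂ τ) ∂(M.trajLaw π θ₁) =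
      gradient (M.J π) θ₁ - gradient (M.J π) θ₂ := by
  have hd : Integrable (fun τ => g θ₁ τ - π.weight θ₁ θ₂ τ • g θ₂ τ) (M.trajLaw π θ₁) :=
    (O.memLp_diff θ₁ θ₂).integrable (by norm_num)
  -- The weight need not be bounded at arbitrary distance; integrability follows from that of the
  -- bounded `g θ₁` and of the difference.
  have hw : Integrable (fun τ => π.weight θ₁ θ₂ τ • g θ₂ τ) (M.trajLaw π θ₁) := by
    refine ((O.integrable_g θ₁ θ₁).sub hd).congr (ae_of_all _ fun τ => ?_)
    simp
  rw [integral_sub (O.integrable_g θ₁ θ₁) hw, MDP.integral_weight_smul, O.gradient_eq,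
    O.gradient_eq]

end GradientOracle

section Batch

variable {Ω : Type*} {α β ε : ℝ} {m B : ℕ} {v : ℕ → Ω → Param d} {k : ℕ}

theorem measurable_batchSize {_ : MeasurableSpace Ω} (hv : ∀ i < k, Measurable (v i)) :
    Measurable fun ω => batchSize α β σ ε m B (fun i => v i ω) k := by
  unfold batchSize
  split_ifs
  · refine Nat.measurable_ceil.comp (measurable_const.div (Measurable.add_const
      (Measurable.const_mul (Finset.measurable_sum _ fun i hi => ?_) _) _))
    exact (hv i (Finset.mem_Ico.1 hi).2).norm.pow_const 2
  · exact measurable_const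

end Batch

namespace IsAbaSVRPG

variable {Ω : Type*} {mΩ : MeasurableSpace Ω} {μ : Measure Ω} [IsProbabilityMeasure μ]
  {ℱ : Filtration ℕ mΩ} {θ₀ : Param d} {η ε α β Q : ℝ} {m B K : ℕ} {θ v : ℕ → Ω → Param d}
  {τ : ℕ → ℕ → Ω → Traj S A M.horizon} {ξ : Ω → Fin (K + 1)}
  (h : IsAbaSVRPG M π g θ₀ η ε σ α β m B K μ ℱ θ v τ ξ)
  (O : GradientOracle M π g σ L Lg Γ C)

include h O

omit [IsProbabilityMeasure μ] in
-- Iterates and estimators are treated in one induction: `v k` uses `θ k` and a batch size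
-- determined by earlier estimators, and `θ (k + 1)` uses `v k`.
theorem adapted_iterates {k : ℕ} (hk : k ≤ K + 1) :
    (∀ i ≤ k, Measurable[ℱ k] (θ i)) ∧ ∀ i < k, Measurable[ℱ k] (v i) := by
  induction k with
  | zero =>
    refine ⟨fun i hi => ?_, fun i hi => absurd hi (Nat.not_lt_zero i)⟩
    rw [Nat.le_zero.1 hi, show θ 0 = fun _ => θ₀ from funext h.init]
    exact measurable_const
  | succ k ih =>
    have hkK : k ≤ K := by omega
    obtain ⟨ihθ, ihv⟩ := ih (by omega)
    have hle : ℱ k ≤ ℱ (k + 1) := ℱ.mono (Nat.le_succ k)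
    have hθ (i : ℕ) (hi : i ≤ k) : Measurable[ℱ (k + 1)] (θ i) := (ihθ i hi).mono hle le_rfl
    have hv (i : ℕ) (hi : i < k) : Measurable[ℱ (k + 1)] (v i) := (ihv i hi).mono hle le_rfl
    have hvk : Measurable[ℱ (k + 1)] (v k) := by
      by_cases hkm : k % m = 0
      · rw [show v k = _ from funext (h.outer k hkK hkm)]
        exact measurable_average (measurable_batchSize hv)
          fun i => O.measurable_g_comp (hθ k le_rfl) (h.adapted k hkK i)
      · have hn : epochStart m k < k := lt_of_le_of_ne (epochStart_le m k) fun he =>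
          hkm (Nat.mod_eq_zero_of_dvd (he ▸ dvd_mul_left m (k / m)))
        rw [show v k = _ from funext (h.inner k hkK hkm)]
        refine (measurable_average measurable_const fun i => ?_).add (hv _ hn)
        refine (O.measurable_g_comp (hθ k le_rfl) (h.adapted k hkK i)).sub
          (Measurable.fun_smul ?_ ?_)
        · exact O.measurable_weight (hθ k le_rfl) (hθ _ hn.le) (h.adapted k hkK i)
        · exact O.measurable_g_comp (hθ _ hn.le) (h.adapted k hkK i)
    refine ⟨fun i hi => ?_, fun i hi => ?_⟩
    · rcases Nat.le_succ_iff.1 hi with hi | rfl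
      · exact hθ i hi
      · rw [show θ (k + 1) = _ from funext (h.update k hkK)]
        exact (hθ k le_rfl).add (Measurable.fun_smul (f := fun _ => η) measurable_const hvk)
    · rcases Nat.lt_succ_iff_lt_or_eq.1 hi with hi | rfl
      · exact hv i hi
      · exact hvk

omit [IsProbabilityMeasure μ] in
theorem measurable_θ {k : ℕ} (hk : k ≤ K + 1) : Measurable (θ k) :=
  ((h.adapted_iterates O hk).1 k le_rfl).mono (ℱ.le k) le_rfl

omit [IsProbabilityMeasure μ] in
theorem measurable_v {k : ℕ} (hk : k ≤ K) : Measurable (v k) :=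
  ((h.adapted_iterates O (Nat.succ_le_succ hk)).2 k (Nat.lt_succ_self k)).mono (ℱ.le _) le_rfl

omit [IsProbabilityMeasure μ] O in
theorem measurable_τ {k : ℕ} (hk : k ≤ K) (i : ℕ) : Measurable (τ k i) :=
  (h.adapted k hk i).mono (ℱ.le _) le_rfl

omit [IsProbabilityMeasure μ] in
-- The sampling axiom is applied to `F ∩ Z ⁻¹' s`. The variable `Z` may carry any past data that
-- determine `θ k`, and `F` fixes the batch size.
theorem condIID [SigmaFinite ν] {k : ℕ} (hk : k ≤ K) {n : ℕ} {F : Set Ω}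
    (hF : MeasurableSet[ℱ k] F)
    (hn : ∀ ω ∈ F, batchSize α β σ ε m B (fun i => v i ω) k = n)
    {E : Type*} [MeasurableSpace E] {Z : Ω → E} (hZ : Measurable[ℱ k] Z) {φ : E → Param d}
    (hφ : Measurable φ) (hφZ : ∀ ω, φ (Z ω) = θ k ω) :
    CondIID (μ.restrict F) Z ((M.trajKernel π).comap φ hφ) n (τ k) := by
  intro s hs D hD
  rw [Measure.restrict_apply' (ℱ.le k _ hF),
    Measure.restrict_restrict (ℱ.le k _ (hZ hs)), Set.inter_right_comm, Set.inter_comm _ F]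
  rw [h.sampling k hk n (F ∩ Z ⁻¹' s)
    (@MeasurableSet.inter _ (ℱ k) _ _ hF (hZ hs)) (fun ω hω => hn ω hω.1) D hD]
  refine lintegral_congr fun ω => ?_
  simp only [Kernel.comap_apply, hφZ, MDP.trajKernel_apply O.continuous_trajDens]

end IsAbaSVRPG

end AbaPG

/-! ### Estimator errors and the final summation -/

namespace AbaPG

open scoped InnerProductSpace

variable {S A : Type*} [MeasurableSpace S] [MeasurableSpace A] {ν : Measure A} {d : ℕ}
  {M : MDP S A} {π : PolicyClass S ν d} {g : Param d → Traj S A M.horizon → Param d}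
  {σ L Lg Γ C : ℝ}

namespace IsAbaSVRPG

variable {Ω : Type*} {mΩ : MeasurableSpace Ω} {μ : Measure Ω} [IsProbabilityMeasure μ]
  {ℱ : Filtration ℕ mΩ} {θ₀ : Param d} {η ε α β : ℝ} {m B K : ℕ} {θ v : ℕ → Ω → Param d}
  {τ : ℕ → ℕ → Ω → Traj S A M.horizon} {ξ : Ω → Fin (K + 1)}
  (h : IsAbaSVRPG M π g θ₀ η ε σ α β m B K μ ℱ θ v τ ξ)
  (O : GradientOracle M π g σ L Lg Γ C)

include h O

theorem memLp_gradient [SigmaFinite ν] {k : ℕ} (hk : k ≤ K + 1) :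
    MemLp (fun ω => gradient (M.J π) (θ k ω)) 2 μ :=
  MemLp.of_bound (O.measurable_gradient.comp (h.measurable_θ O hk)).aestronglyMeasurable (√Γ)
    (ae_of_all _ fun _ => O.norm_gradient_le _)

/-- The error at the start of an epoch. -/
theorem outer_error [SigmaFinite ν] (hσ : 0 < σ) (hα : 0 < α) (hβ : 0 ≤ β) (hε : 0 < ε)
    {k : ℕ} (hk : k ≤ K) (hkm : k % m = 0) (hv : ∀ i < k, MemLp (v i) 2 μ) :
    MemLp (fun ω => v k ω - gradient (M.J π) (θ k ω)) 2 μ ∧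
      ∫ ω, ‖v k ω - gradient (M.J π) (θ k ω)‖ ^ 2 ∂μ ≤
        (β / m * (∑ i ∈ Finset.Ico (k - m) k, ∫ ω, ‖v i ω‖ ^ 2 ∂μ) + ε) / α := by
  set N : Ω → ℕ := fun ω => batchSize α β σ ε m B (fun i => v i ω) k with hN
  set D : Ω → ℝ := fun ω => β / m * ∑ i ∈ Finset.Ico (k - m) k, ‖v i ω‖ ^ 2 + ε with hD
  have hD0 (ω : Ω) : 0 < D ω := by
    have : 0 ≤ ∑ i ∈ Finset.Ico (k - m) k, ‖v i ω‖ ^ 2 :=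
      Finset.sum_nonneg fun i _ => sq_nonneg _
    positivity
  have hNe (ω : Ω) : N ω = ⌈α * σ ^ 2 / D ω⌉₊ := by simp [hN, batchSize, hkm, hD]
  have hN0 (ω : Ω) : 0 < N ω := by
    rw [hNe]
    have := hD0 ω
    exact Nat.ceil_pos.2 (by positivity)
  have hNF : Measurable[ℱ k] N :=
    measurable_batchSize (h.adapted_iterates O (hk.trans (Nat.le_succ K))).2
  have hNm : Measurable N := hNF.mono (ℱ.le k) le_rfl
  have hθF : Measurable[ℱ k] (θ k) :=
    (h.adapted_iterates O (hk.trans (Nat.le_succ K))).1 k le_rfl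
  have hθ := h.measurable_θ O (hk.trans (Nat.le_succ K))
  have hvk (ω : Ω) : v k ω = (N ω : ℝ)⁻¹ • ∑ i ∈ Finset.range (N ω), g (θ k ω) (τ k i ω) :=
    h.outer k hk hkm ω
  -- An average of vectors of norm at most `√Γ` is bounded, whatever the random batch size.
  have hvL : MemLp (v k) 2 μ := by
    refine MemLp.of_bound (h.measurable_v O hk).aestronglyMeasurable (√Γ) (ae_of_all _ fun ω => ?_)
    have hN' : (0 : ℝ) < N ω := by exact_mod_cast hN0 ω
    rw [hvk, norm_smul, norm_inv, Real.norm_of_nonneg hN'.le, inv_mul_le_iff₀ hN']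
    refine (norm_sum_le_of_le _ fun i _ => O.norm_g_le _ _).trans (le_of_eq ?_)
    rw [Finset.sum_const, Finset.card_range, nsmul_eq_mul]
  have hL := hvL.sub (h.memLp_gradient O (hk.trans (Nat.le_succ K)))
  refine ⟨hL, ?_⟩
  have hvi : ∀ i ∈ Finset.Ico (k - m) k, Integrable (fun ω => ‖v i ω‖ ^ 2) μ := fun i hi =>
    (hv i (Finset.mem_Ico.1 hi).2).norm.integrable_sq
  have hsumi : Integrable (fun ω => β / m * ∑ i ∈ Finset.Ico (k - m) k, ‖v i ω‖ ^ 2) μ :=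
    (integrable_finsetSum _ hvi).const_mul _
  have hDi : Integrable D μ := hsumi.add (integrable_const ε)
  have hDint : ∫ ω, D ω / α ∂μ =
      (β / m * (∑ i ∈ Finset.Ico (k - m) k, ∫ ω, ‖v i ω‖ ^ 2 ∂μ) + ε) / α := by
    rw [integral_div, integral_add hsumi (integrable_const ε), integral_const_mul,
      integral_finsetSum _ hvi, integral_const, probReal_univ, one_smul]
  rw [← hDint]
  refine integral_le_integral_of_fiber hNm hL.norm.integrable_sq (hDi.div_const α) fun n => ?_
  rcases Nat.eq_zero_or_pos n with rfl | hn
  · have : N ⁻¹' {0} = ∅ := Set.eq_empty_of_forall_notMem fun ω hω => (hN0 ω).ne' hω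
    simp [this]
  have hF : MeasurableSet (N ⁻¹' {n}) := hNm (measurableSet_singleton n)
  have hn' : (0 : ℝ) < n := by exact_mod_cast hn
  have hcond := h.condIID O hk (hNF (measurableSet_singleton n)) (fun ω hω => hω) hθF
    (φ := id) measurable_id fun ω => rfl
  have := O.isMarkovKernel
  have hh : Measurable fun q : Param d × Traj S A M.horizon =>
      g q.1 q.2 - gradient (M.J π) q.1 :=
    O.measurable_uncurry.sub (O.measurable_gradient.comp measurable_fst)
  have hmain := (hcond.memLp_average_add hn hθ (h.measurable_τ hk)
    (h := fun q => g q.1 q.2 - gradient (M.J π) q.1) hh (v := fun _ => σ ^ 2)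
    (fun z => by
      simp only [Kernel.comap_apply, MDP.trajKernel_apply O.continuous_trajDens, id_eq]
      rw [integral_sub (O.integrable_g _ _) (integrable_const _), integral_const,
        probReal_univ, one_smul, ← O.gradient_eq, sub_self])
    (fun z => by
      simp only [Kernel.comap_apply, MDP.trajKernel_apply O.continuous_trajDens, id_eq]
      exact O.gradVar_le z)
    (fun _ => sq_nonneg σ) (integrable_const _) (W := fun _ => 0) measurable_const
    (memLp_const 0)).2
  simp only [add_zero, norm_zero, zero_pow two_ne_zero, integral_zero] at hmain
  have hint (c : ℝ) : IntegrableOn (fun _ : Ω => c) (N ⁻¹' {n}) μ := integrable_const c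
  calc ∫ ω in N ⁻¹' {n}, ‖v k ω - gradient (M.J π) (θ k ω)‖ ^ 2 ∂μ
      = ∫ ω in N ⁻¹' {n}, ‖(n : ℝ)⁻¹ • ∑ i ∈ Finset.range n,
          (g (θ k ω) (τ k i ω) - gradient (M.J π) (θ k ω))‖ ^ 2 ∂μ := by
        refine setIntegral_congr_fun hF fun ω hω => ?_
        have hω' : N ω = n := hω
        simp only [hvk, hω']
        rw [Finset.sum_sub_distrib, Finset.sum_const, Finset.card_range, smul_sub,
          ← Nat.cast_smul_eq_nsmul ℝ, inv_smul_smul₀ hn'.ne']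
    _ ≤ (n : ℝ)⁻¹ * ∫ _ω in N ⁻¹' {n}, σ ^ 2 ∂μ := hmain
    _ = ∫ _ω in N ⁻¹' {n}, (n : ℝ)⁻¹ * σ ^ 2 ∂μ := (integral_const_mul _ _).symm
    _ ≤ ∫ ω in N ⁻¹' {n}, D ω / α ∂μ := by
        refine setIntegral_mono_on (hint _) (hDi.div_const α).integrableOn hF fun ω hω => ?_
        have hω' : N ω = n := hω
        -- The adaptive batch size is designed for this: `σ²/n ≤ D/α`.
        have hle : α * σ ^ 2 / D ω ≤ n := by
          rw [← hω', hNe]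
          exact Nat.le_ceil _
        rw [div_le_iff₀ (hD0 ω)] at hle
        rw [inv_mul_eq_div, div_le_div_iff₀ hn' hα]
        linarith

omit [IsProbabilityMeasure μ] O in
theorem θ_sub_eq {n k : ℕ} (hnk : n ≤ k) (hk : k ≤ K + 1) (ω : Ω) :
    θ k ω - θ n ω = η • ∑ i ∈ Finset.Ico n k, v i ω := by
  induction k, hnk using Nat.le_induction with
  | base => simp
  | succ k hnk ih =>
    rw [h.update k (by omega), Finset.sum_Ico_succ_top hnk, smul_add, ← ih (by omega)]
    abel

omit [IsProbabilityMeasure μ] O in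
-- Cauchy-Schwarz for a sum of `k - n` steps.
theorem sq_norm_θ_sub_le {n k : ℕ} (hnk : n ≤ k) (hk : k ≤ K + 1) (ω : Ω) :
    ‖θ k ω - θ n ω‖ ^ 2 ≤ η ^ 2 * (((k - n : ℕ) : ℝ) * ∑ i ∈ Finset.Ico n k, ‖v i ω‖ ^ 2) := by
  rw [h.θ_sub_eq hnk hk, norm_smul, mul_pow, Real.norm_eq_abs, sq_abs]
  refine mul_le_mul_of_nonneg_left ?_ (sq_nonneg η)
  refine (pow_le_pow_left₀ (norm_nonneg _) (norm_sum_le _ _) 2).trans ?_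
  simpa using sq_sum_le_card_mul_sum_sq (s := Finset.Ico n k) (f := fun i => ‖v i ω‖)

/-- The error inside an epoch. -/
theorem inner_error [SigmaFinite ν] (hB : 0 < B) {k : ℕ} (hk : k ≤ K) (hkm : k % m ≠ 0)
    (hv : ∀ i < k, MemLp (v i) 2 μ) :
    MemLp (fun ω => v k ω - gradient (M.J π) (θ k ω)) 2 μ ∧
      ∫ ω, ‖v k ω - gradient (M.J π) (θ k ω)‖ ^ 2 ∂μ ≤
        2 * (Lg ^ 2 + Γ * C) / B * η ^ 2 * (((k - epochStart m k : ℕ) : ℝ) *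
          ∑ i ∈ Finset.Ico (epochStart m k) k, ∫ ω, ‖v i ω‖ ^ 2 ∂μ) +
        ∫ ω, ‖v (epochStart m k) ω - gradient (M.J π) (θ (epochStart m k) ω)‖ ^ 2 ∂μ := by
  have hn : epochStart m k < k := lt_of_le_of_ne (epochStart_le m k) fun he =>
    hkm (Nat.mod_eq_zero_of_dvd (he ▸ dvd_mul_left m (k / m)))
  have hinner := h.inner k hk hkm
  set n := epochStart m k with hn_def
  have hk1 : k ≤ K + 1 := hk.trans (Nat.le_succ K)
  obtain ⟨hθF, hvF⟩ := h.adapted_iterates O hk1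
  have hC := O.weight.pos
  have hΓ := O.smooth.Γ_pos
  have hgradm := O.measurable_gradient
  have hB' : (0 : ℝ) < B := by exact_mod_cast hB
  -- The conditioning data: the sampling parameter, the epoch-start parameter and the error
  -- inherited from the epoch start.
  let Z : Ω → Param d × Param d × Param d :=
    fun ω => (θ k ω, θ n ω, v n ω - gradient (M.J π) (θ n ω))
  have hZF : Measurable[ℱ k] Z := (hθF k le_rfl).prodMk
    ((hθF n hn.le).prodMk ((hvF n hn).sub (hgradm.comp (hθF n hn.le))))
  have hZ : Measurable Z := hZF.mono (ℱ.le k) le_rfl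
  have hcond := h.condIID O hk (@MeasurableSet.univ _ (ℱ k)) (n := B)
    (fun ω _ => by simp [batchSize, hkm]) hZF measurable_fst fun ω => rfl
  rw [Measure.restrict_univ] at hcond
  have := O.isMarkovKernel
  let Y : (Param d × Param d × Param d) × Traj S A M.horizon → Param d := fun q =>
    (g q.1.1 q.2 - π.weight q.1.1 q.1.2.1 q.2 • g q.1.2.1 q.2) -
      (gradient (M.J π) q.1.1 - gradient (M.J π) q.1.2.1)
  have hY : Measurable Y := by
    have h1 : Measurable fun q : (Param d × Param d × Param d) × Traj S A M.horizon => q.1.1 :=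
      measurable_fst.fst
    have h2 : Measurable fun q : (Param d × Param d × Param d) × Traj S A M.horizon => q.1.2.1 :=
      measurable_fst.snd.fst
    exact ((O.measurable_g_comp h1 measurable_snd).sub
      ((O.measurable_weight h1 h2 measurable_snd).fun_smul
        (O.measurable_g_comp h2 measurable_snd))).sub ((hgradm.comp h1).sub (hgradm.comp h2))
  have hdiffi (i : ℕ) (hi : i ∈ Finset.Ico n k) : Integrable (fun ω => ‖v i ω‖ ^ 2) μ :=
    (hv i (Finset.mem_Ico.1 hi).2).norm.integrable_sq
  have hsumi : Integrable (fun ω => η ^ 2 * (((k - n : ℕ) : ℝ) *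
      ∑ i ∈ Finset.Ico n k, ‖v i ω‖ ^ 2)) μ :=
    ((integrable_finsetSum _ hdiffi).const_mul _).const_mul _
  have hθi : Integrable (fun ω => ‖θ k ω - θ n ω‖ ^ 2) μ := by
    refine hsumi.mono' (((h.measurable_θ O hk1).sub
      (h.measurable_θ O (hn.le.trans hk1))).norm.pow_const 2).aestronglyMeasurable
      (ae_of_all _ fun ω => ?_)
    rw [Real.norm_of_nonneg (sq_nonneg _)]
    exact h.sq_norm_θ_sub_le hn.le hk1 ω
  have hWL : MemLp (fun ω => (Z ω).2.2) 2 μ :=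
    (hv n hn).sub (h.memLp_gradient O (hn.le.trans hk1))
  have hmain := hcond.memLp_average_add hB hZ (h.measurable_τ hk) hY
    (v := fun z => 2 * (Lg ^ 2 + Γ * C) * ‖z.1 - z.2.1‖ ^ 2)
    (fun z => by
      simp only [Kernel.comap_apply, MDP.trajKernel_apply O.continuous_trajDens, Y]
      rw [integral_sub ((O.memLp_diff _ _).integrable (by norm_num)) (integrable_const _),
        O.integral_diff, integral_const, probReal_univ, one_smul, sub_self])
    (fun z => by
      simp only [Kernel.comap_apply, MDP.trajKernel_apply O.continuous_trajDens, Y]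
      refine le_trans ?_ (O.lintegral_sq_norm_diff_le z.1 z.2.1)
      -- The subtracted gradient difference is the mean, so centring only lowers the second moment.
      rw [← O.integral_diff]
      exact lintegral_sub_integral_le (O.memLp_diff _ _))
    (fun z => by positivity) (hθi.const_mul _) (W := fun z => z.2.2)
    measurable_snd.snd hWL
  have hvk (ω : Ω) : (B : ℝ)⁻¹ • ∑ i ∈ Finset.range B, Y (Z ω, τ k i ω) + (Z ω).2.2 =
      v k ω - gradient (M.J π) (θ k ω) := by
    rw [hinner]
    simp only [Y, Z]
    rw [Finset.sum_sub_distrib _ (fun _ => gradient (M.J π) (θ k ω) - gradient (M.J π) (θ n ω)),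
      Finset.sum_const, Finset.card_range, smul_sub, ← Nat.cast_smul_eq_nsmul ℝ,
      inv_smul_smul₀ hB'.ne']
    abel
  simp only [hvk] at hmain
  refine ⟨hmain.1, hmain.2.trans (add_le_add_left ?_ _)⟩
  rw [integral_const_mul]
  have hθle : ∫ ω, ‖θ k ω - θ n ω‖ ^ 2 ∂μ ≤ η ^ 2 * (((k - n : ℕ) : ℝ) *
      ∑ i ∈ Finset.Ico n k, ∫ ω, ‖v i ω‖ ^ 2 ∂μ) := by
    refine (integral_mono hθi hsumi fun ω => h.sq_norm_θ_sub_le hn.le hk1 ω).trans (le_of_eq ?_)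
    rw [integral_const_mul, integral_const_mul, integral_finsetSum _ hdiffi]
  calc (B : ℝ)⁻¹ * (2 * (Lg ^ 2 + Γ * C) * ∫ ω, ‖θ k ω - θ n ω‖ ^ 2 ∂μ)
      ≤ (B : ℝ)⁻¹ * (2 * (Lg ^ 2 + Γ * C) * (η ^ 2 * (((k - n : ℕ) : ℝ) *
        ∑ i ∈ Finset.Ico n k, ∫ ω, ‖v i ω‖ ^ 2 ∂μ))) := by gcongr
    _ = _ := by ring

/-- Strong induction, because both error estimates require finite second moments of all earlier
estimators. -/
theorem memLp_v [SigmaFinite ν] (hσ : 0 < σ) (hα : 0 < α) (hβ : 0 ≤ β) (hε : 0 < ε)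
    (hB : 0 < B) (k : ℕ) (hk : k ≤ K) : MemLp (v k) 2 μ := by
  induction k using Nat.strong_induction_on with
  | _ k ih =>
    have hv (i : ℕ) (hi : i < k) : MemLp (v i) 2 μ := ih i hi (hi.le.trans hk)
    have he : MemLp (fun ω => v k ω - gradient (M.J π) (θ k ω)) 2 μ := by
      by_cases hkm : k % m = 0
      · exact (h.outer_error O hσ hα hβ hε hk hkm hv).1
      · exact (h.inner_error O hB hk hkm hv).1
    refine (he.add (h.memLp_gradient O (hk.trans (Nat.le_succ K)))).ae_eq
      (ae_of_all _ fun ω => ?_)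
    simp

/-- The error of the gradient estimator in terms of the second moments of the estimators of the
previous and of the current epoch. -/
theorem error_le [SigmaFinite ν] (hσ : 0 < σ) (hα : 0 < α) (hβ : 0 ≤ β) (hε : 0 < ε)
    (hB : 0 < B) {k : ℕ} (hk : k ≤ K) :
    ∫ ω, ‖v k ω - gradient (M.J π) (θ k ω)‖ ^ 2 ∂μ ≤
      β / α / m * (∑ i ∈ Finset.Ico (epochStart m k - m) (epochStart m k),
        ∫ ω, ‖v i ω‖ ^ 2 ∂μ) + ε / α +
      2 * (Lg ^ 2 + Γ * C) / B * η ^ 2 * (((k - epochStart m k : ℕ) : ℝ) *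
          ∑ i ∈ Finset.Ico (epochStart m k) k, ∫ ω, ‖v i ω‖ ^ 2 ∂μ) := by
  have hv := h.memLp_v O hσ hα hβ hε hB
  have houter {n : ℕ} (hn : n ≤ K) (hnm : n % m = 0) :
      ∫ ω, ‖v n ω - gradient (M.J π) (θ n ω)‖ ^ 2 ∂μ ≤
        β / α / m * (∑ i ∈ Finset.Ico (n - m) n, ∫ ω, ‖v i ω‖ ^ 2 ∂μ) + ε / α := by
    refine (h.outer_error O hσ hα hβ hε hn hnm fun i hi => hv i (hi.le.trans hn)).2.trans
      (le_of_eq ?_)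
    ring
  by_cases hkm : k % m = 0
  · have hs : epochStart m k = k := Nat.div_mul_cancel (Nat.dvd_of_mod_eq_zero hkm)
    rw [hs]
    simpa using houter hk hkm
  · have h1 := (h.inner_error O hB hk hkm fun i hi => hv i (hi.le.trans hk)).2
    have h2 := houter ((epochStart_le m k).trans hk) (Nat.mul_mod_left (k / m) m)
    linarith

/-- The output is a uniformly chosen iterate. -/
theorem integral_output [SigmaFinite ν] :
    Integrable (fun ω => ‖gradient (M.J π) (θ (ξ ω) ω)‖ ^ 2) μ ∧
      ∫ ω, ‖gradient (M.J π) (θ (ξ ω) ω)‖ ^ 2 ∂μ =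
        (∑ k ∈ Finset.range (K + 1), ∫ ω, ‖gradient (M.J π) (θ k ω)‖ ^ 2 ∂μ) / (K + 1) := by
  have hs (k : Fin (K + 1)) : MeasurableSet (ξ ⁻¹' {k}) :=
    h.measurable_output (measurableSet_singleton k)
  have hG (k : Fin (K + 1)) : Integrable (fun ω => ‖gradient (M.J π) (θ k ω)‖ ^ 2) μ :=
    (h.memLp_gradient O k.2.le).norm.integrable_sq
  have hexp : (fun ω => ‖gradient (M.J π) (θ (ξ ω) ω)‖ ^ 2) = fun ω => ∑ k : Fin (K + 1),
      (ξ ⁻¹' {k}).indicator (fun ω => ‖gradient (M.J π) (θ k ω)‖ ^ 2) ω := by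
    funext ω
    rw [Finset.sum_eq_single (ξ ω)]
    · simp
    · intro k _ hk
      have hne : ω ∉ ξ ⁻¹' {k} := fun hω => hk (Set.mem_singleton_iff.1 hω).symm
      exact Set.indicator_of_notMem hne _
    · simp
  have hI (k : Fin (K + 1)) : Integrable
      ((ξ ⁻¹' {k}).indicator fun ω => ‖gradient (M.J π) (θ k ω)‖ ^ 2) μ :=
    (hG k).indicator (hs k)
  rw [hexp]
  refine ⟨integrable_finsetSum _ fun k _ => hI k, ?_⟩
  rw [integral_finsetSum _ fun k _ => hI k, Finset.sum_div,
    ← Fin.sum_univ_eq_sum_range (fun k => (∫ ω, ‖gradient (M.J π) (θ k ω)‖ ^ 2 ∂μ) / (K + 1))]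
  refine Finset.sum_congr rfl fun k _ => ?_
  -- Independence splits off the probability `1/(K + 1)` of the event `ξ = k`.
  have hind : IndepFun (fun ω => ({k} : Set (Fin (K + 1))).indicator (fun _ => (1 : ℝ)) (ξ ω))
      (fun ω => ‖gradient (M.J π) (θ k ω)‖ ^ 2) μ :=
    h.indep_output.comp (φ := ({k} : Set (Fin (K + 1))).indicator fun _ => (1 : ℝ))
      (ψ := fun x : Fin (K + 1) → Param d => ‖gradient (M.J π) (x k)‖ ^ 2)
      ((measurable_const (a := (1 : ℝ))).indicator (measurableSet_singleton k))
      ((O.measurable_gradient.comp (measurable_pi_apply k)).norm.pow_const 2)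
  have hmul := hind.integral_fun_mul_eq_mul_integral
    ((((measurable_const (a := (1 : ℝ))).indicator (measurableSet_singleton k)).comp
      h.measurable_output).aestronglyMeasurable) (hG k).aestronglyMeasurable
  have hprob : ∫ ω, ({k} : Set (Fin (K + 1))).indicator (fun _ => (1 : ℝ)) (ξ ω) ∂μ =
      ((K : ℝ) + 1)⁻¹ := by
    have : (fun ω => ({k} : Set (Fin (K + 1))).indicator (fun _ => (1 : ℝ)) (ξ ω)) =
        (ξ ⁻¹' {k}).indicator fun _ => (1 : ℝ) := rfl
    rw [this, integral_indicator_const _ (hs k), measureReal_def, h.uniform_output k,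
      smul_eq_mul, mul_one, ENNReal.toReal_inv]
    norm_num [ENNReal.toReal_add]
  rw [hprob] at hmul
  rw [div_eq_inv_mul, ← hmul]
  refine integral_congr_ae (ae_of_all _ fun ω => ?_)
  by_cases hω : ξ ω = k
  · simp [Set.indicator, hω]
  · simp [Set.indicator, hω]

end IsAbaSVRPG

/-- The convergence bound, with the constants that the proof yields. -/
theorem IsAbaSVRPG.sum_integral_le [SigmaFinite ν] {Ω : Type*} {mΩ : MeasurableSpace Ω}
    {μ : Measure Ω} [IsProbabilityMeasure μ] {ℱ : Filtration ℕ mΩ} {θ₀ θs : Param d} {ε : ℝ}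
    {m B K : ℕ} {θ v : ℕ → Ω → Param d} {τ : ℕ → ℕ → Ω → Traj S A M.horizon}
    {ξ : Ω → Fin (K + 1)}
    (h : IsAbaSVRPG M π g θ₀ (1 / (2 * L)) ε σ 48 6 m B K μ ℱ θ v τ ξ)
    (O : GradientOracle M π g σ L Lg Γ C) (hσ : 0 < σ) (hε : 0 < ε) (hm : 0 < m) (hB : 0 < B)
    (hmB : 2 * (Lg ^ 2 + Γ * C) * ((m : ℝ) - 1) ^ 2 ≤ L ^ 2 * B)
    (hs : ∀ θ, M.J π θ ≤ M.J π θs) :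
    ∑ k ∈ Finset.range (K + 1), ∫ ω, ‖gradient (M.J π) (θ k ω)‖ ^ 2 ∂μ ≤
      4 * L * (M.J π θs - M.J π θ₀) + (K + 1) * (ε / 48) := by
  have hL := O.smooth.L_pos
  have hC := O.weight.pos
  have hΓ := O.smooth.Γ_pos
  have hB' : (0 : ℝ) < B := by exact_mod_cast hB
  have hvL := h.memLp_v O hσ (by norm_num) (by norm_num) hε hB
  obtain ⟨D, hD⟩ := O.exists_abs_J_le
  have hJi {k : ℕ} (hk : k ≤ K + 1) : Integrable (fun ω => M.J π (θ k ω)) μ :=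
    Integrable.of_bound (O.differentiable.continuous.measurable.comp
      (h.measurable_θ O hk)).aestronglyMeasurable D (ae_of_all _ fun ω => hD _)
  set a : ℕ → ℝ := fun k => ∫ ω, ‖v k ω‖ ^ 2 ∂μ with ha
  set e : ℕ → ℝ := fun k => ∫ ω, ‖v k ω - gradient (M.J π) (θ k ω)‖ ^ 2 ∂μ with he
  set G : ℕ → ℝ := fun k => ∫ ω, ‖gradient (M.J π) (θ k ω)‖ ^ 2 ∂μ with hG
  set j : ℕ → ℝ := fun k => ∫ ω, M.J π (θ k ω) ∂μ with hj
  have ha0 (k : ℕ) : 0 ≤ a k := integral_nonneg fun ω => sq_nonneg _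
  have hstep (k : ℕ) (hk : k ≤ K) :
      1 / (4 * L) * G k + 1 / (8 * L) * a k - 1 / (4 * L) * e k ≤ j (k + 1) - j k := by
    have hk1 : k ≤ K + 1 := hk.trans (Nat.le_succ K)
    have hGi : Integrable (fun ω => ‖gradient (M.J π) (θ k ω)‖ ^ 2) μ :=
      (h.memLp_gradient O hk1).norm.integrable_sq
    have hai : Integrable (fun ω => ‖v k ω‖ ^ 2) μ := (hvL k hk).norm.integrable_sq
    have hei : Integrable (fun ω => ‖v k ω - gradient (M.J π) (θ k ω)‖ ^ 2) μ :=
      ((hvL k hk).sub (h.memLp_gradient O hk1)).norm.integrable_sq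
    have hlhs : Integrable (fun ω => 1 / (4 * L) * ‖gradient (M.J π) (θ k ω)‖ ^ 2 +
        1 / (8 * L) * ‖v k ω‖ ^ 2) μ := (hGi.const_mul _).add (hai.const_mul _)
    simp only [hG, ha, he, hj]
    rw [← integral_const_mul, ← integral_const_mul, ← integral_const_mul,
      ← integral_add (hGi.const_mul _) (hai.const_mul _),
      ← integral_sub hlhs (hei.const_mul _), ← integral_sub (hJi (by omega)) (hJi hk1)]
    refine integral_mono (hlhs.sub (hei.const_mul _)) ((hJi (by omega)).sub (hJi hk1))
      fun ω => ?_
    have := ascent_step O.differentiable hL O.smooth.gradient_lipschitz (θ k ω) (v k ω)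
    rw [← h.update k hk ω] at this
    simp only
    linarith
  have htel : ∑ k ∈ Finset.range (K + 1),
      (1 / (4 * L) * G k + 1 / (8 * L) * a k - 1 / (4 * L) * e k) ≤
        M.J π θs - M.J π θ₀ := by
    calc _ ≤ ∑ k ∈ Finset.range (K + 1), (j (k + 1) - j k) :=
          Finset.sum_le_sum fun k hk => hstep k (Nat.lt_succ_iff.1 (Finset.mem_range.1 hk))
      _ = j (K + 1) - j 0 := Finset.sum_range_sub j (K + 1)
      _ ≤ _ := by
        have h0 : j 0 = M.J π θ₀ := by simp [hj, h.init]
        have h1 : j (K + 1) ≤ M.J π θs := by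
          refine (integral_mono (hJi le_rfl) (integrable_const _) fun ω => hs _).trans
            (le_of_eq ?_)
          simp
        linarith
  -- Here `6 / 48` is `β/α`, and `c` is `Qη²/B` with `η = 1/(2L)`.
  have herr := sum_error_le hm ha0 (e := e) (a := 6 / 48) (δ := ε / 48) (n := K + 1)
    (c := 2 * (Lg ^ 2 + Γ * C) / B * (1 / (2 * L)) ^ 2) (by norm_num) (by positivity)
    fun k hk => h.error_le O hσ (by norm_num) (by norm_num) hε hB (Nat.lt_succ_iff.1 hk)
  have hcoef : 2 * (Lg ^ 2 + Γ * C) / B * (1 / (2 * L)) ^ 2 * ((m : ℝ) - 1) ^ 2 ≤ 1 / 4 := by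
    rw [show 2 * (Lg ^ 2 + Γ * C) / B * (1 / (2 * L)) ^ 2 * ((m : ℝ) - 1) ^ 2 =
      (2 * (Lg ^ 2 + Γ * C) * ((m : ℝ) - 1) ^ 2) / (4 * (L ^ 2 * B)) by field_simp; ring,
      div_le_iff₀ (by positivity)]
    linarith
  have hsa : 0 ≤ ∑ k ∈ Finset.range (K + 1), a k := Finset.sum_nonneg fun k _ => ha0 k
  rw [Finset.sum_sub_distrib, Finset.sum_add_distrib, ← Finset.mul_sum, ← Finset.mul_sum,
    ← Finset.mul_sum] at htel
  -- The coefficient `1/8 + 1/4` is relaxed to `1/2`, the amount of `∑ a k` that the ascent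
  -- inequality supplies.
  have herr' : ∑ k ∈ Finset.range (K + 1), e k ≤
      1 / 2 * ∑ k ∈ Finset.range (K + 1), a k + (K + 1) * (ε / 48) := by
    refine herr.trans ?_
    push_cast
    have := mul_le_mul_of_nonneg_right hcoef hsa
    linarith
  have h4 := mul_le_mul_of_nonneg_left htel (by positivity : 0 ≤ 4 * L)
  have h5 : 4 * L * (1 / (4 * L) * ∑ k ∈ Finset.range (K + 1), G k +
      1 / (8 * L) * ∑ k ∈ Finset.range (K + 1), a k -
      1 / (4 * L) * ∑ k ∈ Finset.range (K + 1), e k) = ∑ k ∈ Finset.range (K + 1), G k +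
      1 / 2 * ∑ k ∈ Finset.range (K + 1), a k - ∑ k ∈ Finset.range (K + 1), e k := by
    field_simp
    ring
  rw [h5] at h4
  linarith

end AbaPG

theorem theorem3 {S A : Type*} [MeasurableSpace S] [MeasurableSpace A]
    (ν : MeasureTheory.Measure A) [MeasureTheory.SigmaFinite ν] (d : ℕ)
    (M : AbaPG.MDP S A) (π : AbaPG.PolicyClass S ν d)
    -- the trajectory gradient: REINFORCE or G(PO)MDP, with a bounded baseline
    (b : S → A → ℝ) (hb_meas : Measurable (Function.uncurry b))
    (hb : ∃ C : ℝ, ∀ s a, |b s a| ≤ C)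
    (g : AbaPG.Param d → AbaPG.Traj S A M.horizon → AbaPG.Param d)
    (hg : g = M.reinforce π b ∨ g = M.gpomdp π b)
    -- unbiasedness
    (h_unbiased : ∀ θ, HasGradientAt (M.J π) (∫ τ, g θ τ ∂(M.trajLaw π θ)) θ)
    -- bounded reward, bounded gradient and Hessian of the log-policy
    (G H R : ℝ) (h_reward : ∀ s a, |M.reward s a| ≤ R) (h_log : π.BoundedLogDerivs G H)
    -- bounded variance
    (σ : ℝ) (hσ : 0 < σ) (h_var : ∀ θ, M.gradVar π g θ ≤ ENNReal.ofReal (σ ^ 2)) :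
    -- the constants that determine the parameters exist ...
    (∃ L Lg Γ : ℝ, M.SmoothnessConsts π g L Lg Γ) ∧
    ((∃ W : ℝ, ∀ θ₁ θ₂, M.weightVar π θ₁ θ₂ ≤ ENNReal.ofReal W) → ∃ C : ℝ, M.WeightConst π C) ∧
    -- ... and for every choice of them the algorithm satisfies the bound
    ∀ L Lg Γ C Q : ℝ, M.SmoothnessConsts π g L Lg Γ → M.WeightConst π C →
      Q = 2 * (Lg ^ 2 + Γ * C) →
      ∀ (ε : ℝ) (m B K : ℕ) (θ₀ θs : AbaPG.Param d), 0 < ε →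
        0 < m → |(m : ℝ) - (L ^ 2 * σ ^ 2 / (Q * ε)) ^ (1 / 3 : ℝ)| < 1 →
        B = ⌈(Q * σ ^ 4 / (L ^ 2 * ε ^ 2)) ^ (1 / 3 : ℝ)⌉₊ →
        (∀ θ, M.J π θ ≤ M.J π θs) →
        ∀ {Ω : Type*} [mΩ : MeasurableSpace Ω] (μ : MeasureTheory.Measure Ω)
          [MeasureTheory.IsProbabilityMeasure μ] (ℱ : MeasureTheory.Filtration ℕ mΩ)
          (θ v : ℕ → Ω → AbaPG.Param d) (τ : ℕ → ℕ → Ω → AbaPG.Traj S A M.horizon)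
          (ξ : Ω → Fin (K + 1)),
          AbaPG.IsAbaSVRPG M π g θ₀ (1 / (2 * L)) ε σ 48 6 m B K μ ℱ θ v τ ξ →
          MeasureTheory.Integrable (fun ω => ‖gradient (M.J π) (θ (ξ ω) ω)‖ ^ 2) μ ∧
          ∫ ω, ‖gradient (M.J π) (θ (ξ ω) ω)‖ ^ 2 ∂μ ≤
            88 * L / (K + 1) * (M.J π θs - M.J π θ₀) + ε / 2 := by 
  refine ⟨AbaPG.MDP.exists_smoothnessConsts hb_meas hb hg h_unbiased h_reward h_log,
    AbaPG.MDP.exists_weightConst h_log, ?_⟩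
  intro L Lg Γ C Q hsmooth hweight hQ ε m B K θ₀ θs hε hm hmx hB hs Ω mΩ μ _ ℱ θ v τ ξ hrun
  have O : AbaPG.GradientOracle M π g σ L Lg Γ C :=
    { smooth := hsmooth
      weight := hweight
      continuous_trajDens := h_log.continuous_trajDens
      measurable := AbaPG.MDP.measurable_g hb_meas hg h_log
      hasGradientAt := h_unbiased
      gradVar_le := h_var
      exists_abs_J_le := ⟨_, AbaPG.MDP.abs_J_le h_reward⟩ }
  have hL := hsmooth.L_pos
  have hC := hweight.pos
  have hΓ := hsmooth.Γ_pos
  have hQ0 : 0 < Q := by rw [hQ]; positivity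
  have hB0 : 0 < B := by rw [hB]; exact Nat.ceil_pos.2 (by positivity)
  have hmB : 2 * (Lg ^ 2 + Γ * C) * ((m : ℝ) - 1) ^ 2 ≤ L ^ 2 * B := by
    rw [← hQ, hB]
    exact AbaPG.mul_sub_one_sq_le hL hσ hQ0 hε hm hmx
  obtain ⟨hint, heq⟩ := hrun.integral_output O
  refine ⟨hint, ?_⟩
  have hK : (0 : ℝ) < (K : ℝ) + 1 := by positivity
  have hJ : 0 ≤ M.J π θs - M.J π θ₀ := sub_nonneg.2 (hs θ₀)
  rw [heq, div_le_iff₀ hK]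
  refine (hrun.sum_integral_le O hσ hε hm hB0 hmB hs).trans ?_
  have h1 : (88 * L / (K + 1) * (M.J π θs - M.J π θ₀) + ε / 2) * (K + 1) =
      88 * L * (M.J π θs - M.J π θ₀) + (K + 1) * (ε / 2) := by
    field_simp
  rw [h1]
  -- The constants `4L` and `ε/48` obtained are smaller than `88L` and `ε/2`; maximality of `θs`
  -- gives the sign needed to enlarge the first.
  have h2 := mul_nonneg hL.le hJ
  have h3 := mul_pos hK hε
  linarith
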